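/- Let $G_1,G_2$ be finitely generated groups of polynomial growth, that is, for $i=1,2$ and some finite symmetric generating set $S$ of $G_i$ there are $d_i,a,b>0$ with $a n^{d_i}\le |B_S(n)|\le b n^{d_i}$ for all $n\ge 1$, where $B_S(n)$ is the ball of radius $n$ about the identity for the word length $\ell_S$; write $\deg(G_i)=d_i$ and assume $\deg(G_2)=1$. Let $G=G_1\times G_2$, let $S_1,S_2$ be finite symmetric generating sets of $G_1,G_2$, and put $|g|_\infty=\max\{\ell_{S_1}(g_1),\ell_{S_2}(g_2)\}$ for $g=(g_1,g_2)\in G$. Let $A$ be a finite set with the discrete topology, let $G$ act on $A^G$ by $(hx)_g=x_{gh}$, and let $\mathcal X\subset A^G$ be a nonempty subshift (a closed $G$-invariant set), with the metric $d(x,y)=2^{-\min\{|g|_\infty:\,x_g\ne y_g\}}$ for $x\neq y$ and $d(x,x)=0$. The group $G_1$ acts on $\mathcal X$ by $(\sigma_{1,g}x)_{(g_1,g_2)}=x_{(g_1g,g_2)}$; for a finite nonempty $F\subset G_1$ let $d_F(x,y)=\max_{g\in F}d(\sigma_{1,g}x,\sigma_{1,g}y)$. All logarithms are to base two. A sequence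 $(F_n)$ of finite nonempty subsets of a group is called Følner if $|KF_n\,\triangle\,F_n|/|F_n|\to 0$ for every finite nonempty set $K$. For a metric $\rho$ on $\mathcal X$ let $\#(\mathcal X,\rho,\epsilon)$ be the least number of open sets of $\rho$-diameter less than $\epsilon$ covering $\mathcal X$, let $H^s_\epsilon(\mathcal X,\rho)$ be the infimum of $\sum_{n}(\operatorname{diam}E_n)^s$ over countable covers $\mathcal X=\bigcup_n E_n$ with $\operatorname{diam}E_n<\epsilon$ for all $n$, and let $\dim_H(\mathcal X,\rho,\epsilon)=\sup\{s\ge0: H^s_\epsilon(\mathcal X,\rho)\ge1\}$. For Følner sequences $(F_n)$ in $G_1$ and $(E_n)$ in $G$ put $$S(\mathcal X,G_1,d,\epsilon)=\lim_{n\to\infty}\frac{\log\#(\mathcal X,d_{F_n},\epsilon)}{|F_n|},\qquad h_{top}(\mathcal X,G)=\lim_{n\to\infty}\frac{\log|\pi_{E_n}(\mathcal X)|}{|E_n|},$$ where $\pi_E:\mathcal X\to A^E$ is the restriction. The upper and lower metric mean dimensions $\overline{\mathrm{mdim}}_M(\mathcal X,G_1,d)$ and $\underline{\mathrm{mdim}}_M(\mathcal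 X,G_1,d)$ are the $\limsup$ and $\liminf$ of $S(\mathcal X,G_1,d,\epsilon)/|\log\epsilon|$ as $\epsilon\to0$. The upper and lower mean Hausdorff dimensions $\overline{\mathrm{mdim}}_H(\mathcal X,\{F_n\},d)$ and $\underline{\mathrm{mdim}}_H(\mathcal X,\{F_n\},d)$ are the limits, as $\epsilon\to0$, of the $\limsup$ and $\liminf$ over $n$ of $\dim_H(\mathcal X,d_{F_n},\epsilon)/|F_n|$. Let $$c_1=\limsup_{n\to\infty}\frac{|B_{S_2}(n)|}{n},\qquad c_2=\liminf_{n\to\infty}\frac{|B_{S_2}(n)|}{n}.$$ Then, for all Følner sequences $(F_n)$ in $G_1$ and $(E_n)$ in $G$, the limits defining $S(\mathcal X,G_1,d,\epsilon)$ (for every $\epsilon>0$) and $h_{top}(\mathcal X,G)$ exist, the balls $B_{S_1}(n)$ form a Følner sequence, and (1) $\overline{\mathrm{mdim}}_M(\mathcal X,G_1,d)\le c_1\cdot h_{top}(\mathcal X,G)$; (2) $\underline{\mathrm{mdim}}_H(\mathcal X,\{B_{S_1}(n)\},d)\ge c_2\cdot h_{top}(\mathcal X,G)$. In particular, if $c_1=c_2=c$,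 then $$\overline{\mathrm{mdim}}_H(\mathcal X,\{B_{S_1}(n)\},d)=\underline{\mathrm{mdim}}_H(\mathcal X,\{B_{S_1}(n)\},d)=\overline{\mathrm{mdim}}_M(\mathcal X,G_1,d)=\underline{\mathrm{mdim}}_M(\mathcal X,G_1,d)=c\cdot h_{top}(\mathcal X,G).$$ -/

import Mathlib

open Filter Topology Set
open scoped NNReal ENNReal Pointwise symmDiff

namespace SubshiftMeanDim

/-! ### Word length, balls and growth -/

/-- A finite symmetric generating set of a group. -/
structure SymmGenSet (Γ : Type*) [Group Γ] where
  carrier : Finset Γ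
  inv_mem : ∀ s ∈ carrier, s⁻¹ ∈ carrier
  closure_eq_top : Subgroup.closure (carrier : Set Γ) = ⊤

namespace SymmGenSet

variable {Γ : Type*} [Group Γ] (S : SymmGenSet Γ)

/-- The word length: the least `n` such that `g` is a product of `n` elements of `S`. -/
noncomputable def wordLength (g : Γ) : ℕ :=
  sInf {n : ℕ | ∃ l : List Γ, l.length = n ∧ (∀ s ∈ l, s ∈ S.carrier) ∧ l.prod = g}

theorem exists_list (g : Γ) : ∃ l : List Γ, (∀ s ∈ l, s ∈ S.carrier) ∧ l.prod = g := by
  have hg : g ∈ Subgroup.closure (S.carrier : Set Γ) := by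
    rw [S.closure_eq_top]; trivial
  rw [← Subgroup.mem_toSubmonoid, Subgroup.closure_toSubmonoid] at hg
  obtain ⟨l, hl, hp⟩ := Submonoid.exists_list_of_mem_closure hg
  refine ⟨l, fun s hs => ?_, hp⟩
  rcases hl s hs with h | h
  · exact h
  · simpa using S.inv_mem _ h

theorem exists_list_length_eq (g : Γ) :
    ∃ l : List Γ, l.length = S.wordLength g ∧ (∀ s ∈ l, s ∈ S.carrier) ∧ l.prod = g := by
  obtain ⟨l, hl, hp⟩ := S.exists_list g
  exact Nat.sInf_mem (s := {n : ℕ | ∃ l : List Γ, l.length = n ∧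
    (∀ s ∈ l, s ∈ S.carrier) ∧ l.prod = g}) ⟨l.length, l, rfl, hl, hp⟩

theorem finite_ball (n : ℕ) : {g : Γ | S.wordLength g ≤ n}.Finite := by
  have h : {l : List S.carrier | l.length ≤ n}.Finite := List.finite_length_le _ n
  refine (h.image fun l => (l.map Subtype.val).prod).subset ?_
  intro g hg
  obtain ⟨l, hlen, hmem, hp⟩ := S.exists_list_length_eq g
  refine ⟨l.attach.map fun s => ⟨s.1, hmem _ s.2⟩, ?_, ?_⟩
  · simpa [hlen] using hg
  · simpa [List.map_map, Function.comp_def] using hp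

/-- The ball of radius `n` centred at the identity, for the word length. -/
noncomputable def ball (n : ℕ) : Finset Γ := (S.finite_ball n).toFinset

end SymmGenSet

/-- `Γ` is finitely generated of polynomial growth of degree `d > 0`: for some finite symmetric
generating set there are `a, b > 0` with `a n ^ d ≤ |ball n| ≤ b n ^ d` for all `n ≥ 1`. -/
def HasPolynomialGrowth (Γ : Type*) [Group Γ] (d : ℝ) : Prop :=
  0 < d ∧ ∃ S : SymmGenSet Γ, ∃ a b : ℝ, 0 < a ∧ 0 < b ∧ ∀ n : ℕ, 1 ≤ n →
    a * (n : ℝ) ^ d ≤ ((S.ball n).card : ℝ) ∧ ((S.ball n).card : ℝ) ≤ b * (n : ℝ) ^ d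

/-- A (left) Følner sequence of finite non-empty subsets of a group. -/
def IsFolnerSeq {Γ : Type*} [Group Γ] (F : ℕ → Finset Γ) : Prop :=
  (∀ n, (F n).Nonempty) ∧ ∀ K : Finset Γ, K.Nonempty → ∀ δ : ℝ, 0 < δ → ∀ᶠ n in atTop,
    (((((K : Set Γ) * (F n : Set Γ)) ∆ (F n : Set Γ)).ncard : ℕ) : ℝ) < δ * ((F n).card : ℝ)

/-! ### Metric mean dimension and mean Hausdorff dimension -/

/-- Logarithm to base two of a natural number, as an extended nonnegative number. -/
noncomputable def log2 (n : ℕ) : ℝ≥0∞ := ENNReal.ofReal (Real.logb 2 n)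

section MeanDimension

variable {X : Type*}

/-- The diameter of a set with respect to `d`. -/
noncomputable def diam (d : X → X → ℝ≥0) (E : Set X) : ℝ≥0∞ :=
  ⨆ x ∈ E, ⨆ y ∈ E, (d x y : ℝ≥0∞)

/-- The metric `d_F (x, y) = max_{g ∈ F} d (g x, g y)`, for an action `T` on `X`. -/
noncomputable def dynDist {Γ : Type*} (T : Γ → X → X) (d : X → X → ℝ≥0) (F : Finset Γ) :
    X → X → ℝ≥0 :=
  fun x y => F.sup fun g => d (T g x) (T g y)

/-- The least number of open sets of `d`-diameter less than `ε` that cover `X`. -/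
noncomputable def openCoveringNumber [TopologicalSpace X] (d : X → X → ℝ≥0) (ε : ℝ) : ℕ :=
  sInf {n : ℕ | ∃ U : Fin n → Set X, (∀ i, IsOpen (U i)) ∧
    (∀ i, diam d (U i) < ENNReal.ofReal ε) ∧ ⋃ i, U i = univ}

/-- `H^s_ε (X, d)`: infimum of `∑ (diam E_n) ^ s` over countable covers of mesh less than `ε`. -/
noncomputable def hausdorffSum (d : X → X → ℝ≥0) (s : ℝ≥0) (ε : ℝ) : ℝ≥0∞ :=
  ⨅ (E : ℕ → Set X) (_ : ⋃ n, E n = univ) (_ : ∀ n, diam d (E n) < ENNReal.ofReal ε),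
    ∑' n, diam d (E n) ^ (s : ℝ)

/-- `dim_H (X, d, ε) = sup {s ≥ 0 | H^s_ε (X, d) ≥ 1}`. -/
noncomputable def hausdorffDimAt (d : X → X → ℝ≥0) (ε : ℝ) : ℝ≥0∞ :=
  ⨆ (s : ℝ≥0) (_ : 1 ≤ hausdorffSum d s ε), (s : ℝ≥0∞)

theorem hausdorffDimAt_anti (d : X → X → ℝ≥0) : Antitone (hausdorffDimAt d) := by
  intro ε ε' h
  refine iSup_mono fun s => iSup_mono' fun hs => ⟨hs.trans ?_, le_rfl⟩
  refine iInf_mono fun E => iInf_mono fun _ => iInf_mono' fun hE => ⟨fun n => ?_, le_rfl⟩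
  exact (hE n).trans_le (ENNReal.ofReal_le_ofReal h)

variable {Γ : Type*} (T : Γ → X → X) (d : X → X → ℝ≥0) (F : ℕ → Finset Γ)

/-- `limsup_n dim_H (X, d_{F n}, ε) / |F n|`. -/
noncomputable def upperHausdorffRate (ε : ℝ) : ℝ≥0∞ :=
  limsup (fun n => hausdorffDimAt (dynDist T d (F n)) ε / ((F n).card : ℝ≥0∞)) atTop

/-- `liminf_n dim_H (X, d_{F n}, ε) / |F n|`. -/
noncomputable def lowerHausdorffRate (ε : ℝ) : ℝ≥0∞ :=
  liminf (fun n => hausdorffDimAt (dynDist T d (F n)) ε / ((F n).card : ℝ≥0∞)) atTop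

/-- Upper mean Hausdorff dimension, the limit of `upperHausdorffRate` as `ε → 0`
(see `tendsto_upperHausdorffRate`). -/
noncomputable def upperMeanHausdorffDim : ℝ≥0∞ :=
  limsup (upperHausdorffRate T d F) (𝓝[>] 0)

/-- Lower mean Hausdorff dimension, the limit of `lowerHausdorffRate` as `ε → 0`
(see `tendsto_lowerHausdorffRate`). -/
noncomputable def lowerMeanHausdorffDim : ℝ≥0∞ :=
  limsup (lowerHausdorffRate T d F) (𝓝[>] 0)

theorem tendsto_upperHausdorffRate :
    Tendsto (upperHausdorffRate T d F) (𝓝[>] 0) (𝓝 (upperMeanHausdorffDim T d F)) := by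
  have h : Antitone (upperHausdorffRate T d F) := fun ε ε' hε =>
    limsup_le_limsup (Eventually.of_forall fun n =>
      ENNReal.div_le_div_right (hausdorffDimAt_anti _ hε) _)
  have := h.tendsto_nhdsGT 0
  rwa [upperMeanHausdorffDim, this.limsup_eq]

theorem tendsto_lowerHausdorffRate :
    Tendsto (lowerHausdorffRate T d F) (𝓝[>] 0) (𝓝 (lowerMeanHausdorffDim T d F)) := by
  have h : Antitone (lowerHausdorffRate T d F) := fun ε ε' hε =>
    liminf_le_liminf (Eventually.of_forall fun n =>
      ENNReal.div_le_div_right (hausdorffDimAt_anti _ hε) _)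
  have := h.tendsto_nhdsGT 0
  rwa [lowerMeanHausdorffDim, this.limsup_eq]

variable [TopologicalSpace X]

/-- `log # (X, d_{F n}, ε) / |F n|`. -/
noncomputable def coverRate (ε : ℝ) (n : ℕ) : ℝ≥0∞ :=
  log2 (openCoveringNumber (dynDist T d (F n)) ε) / ((F n).card : ℝ≥0∞)

/-- `S (X, d, ε)`, the limit of `coverRate` along the Følner sequence `F`. -/
noncomputable def coverEntropy (ε : ℝ) : ℝ≥0∞ := limsup (coverRate T d F ε) atTop

/-- Upper metric mean dimension. -/
noncomputable def upperMetricMeanDim : ℝ≥0∞ :=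
  limsup (fun ε : ℝ => coverEntropy T d F ε / ENNReal.ofReal |Real.logb 2 ε|) (𝓝[>] 0)

/-- Lower metric mean dimension. -/
noncomputable def lowerMetricMeanDim : ℝ≥0∞ :=
  liminf (fun ε : ℝ => coverEntropy T d F ε / ENNReal.ofReal |Real.logb 2 ε|) (𝓝[>] 0)

end MeanDimension

/-! ### Subshifts -/

/-- The left shift action on configurations: `(g x)_h = x_{h g}`. -/
def shift {Γ A : Type*} [Group Γ] (g : Γ) (x : Γ → A) : Γ → A := fun h => x (h * g)

/-- A subshift: a closed subset of `A ^ Γ` invariant under the action `shift`. Mathlib's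
`MulSubshift` uses the other convention `(g x)_h = x_{g h}`, hence is not used here. -/
structure Subshift (Γ A : Type*) [Group Γ] [TopologicalSpace A] where
  carrier : Set (Γ → A)
  isClosed : IsClosed carrier
  shift_mem : ∀ g : Γ, ∀ x ∈ carrier, shift g x ∈ carrier

namespace Subshift

variable {Γ A : Type*} [Group Γ] [TopologicalSpace A] (𝒳 : Subshift Γ A)

/-- `log |π_{E n} (𝒳)| / |E n|`, with `π_E` the restriction of configurations to `E`. -/
noncomputable def patternRate (E : ℕ → Finset Γ) (n : ℕ) : ℝ≥0∞ :=
  log2 (((E n).restrict (π := fun _ => A)) '' 𝒳.carrier).ncard / ((E n).card : ℝ≥0∞)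

/-- Topological entropy (to base two) of the subshift: the exponential growth rate of its
projections along the Følner sequence `E`. -/
noncomputable def topEntropy (E : ℕ → Finset Γ) : ℝ≥0∞ := limsup (𝒳.patternRate E) atTop

end Subshift

section Product

variable {G₁ G₂ A : Type*} [Group G₁] [Group G₂]

/-- `|g|_∞`, the maximum of the word lengths of the two coordinates. -/
noncomputable def supLength (S₁ : SymmGenSet G₁) (S₂ : SymmGenSet G₂) (g : G₁ × G₂) : ℕ :=
  max (S₁.wordLength g.1) (S₂.wordLength g.2)

open Classical in
/-- The metric `d (x, y) = 2 ^ (- min {|g|_∞ : x_g ≠ y_g})` on configurations, and `d (x, x) = 0`. -/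
noncomputable def configDist (S₁ : SymmGenSet G₁) (S₂ : SymmGenSet G₂) (x y : G₁ × G₂ → A) : ℝ≥0 :=
  if x = y then 0 else (2⁻¹ : ℝ≥0) ^ sInf (supLength S₁ S₂ '' {g | x g ≠ y g})

variable [TopologicalSpace A]

/-- The `G₁`-shift `σ₁` on a subshift over `G₁ × G₂`:
`(σ_{1,g} x)_{(g₁, g₂)} = x_{(g₁ g, g₂)}`. -/
def Subshift.sigmaOne (𝒳 : Subshift (G₁ × G₂) A) (g : G₁) (x : 𝒳.carrier) : 𝒳.carrier :=
  ⟨fun p => x.1 (p.1 * g, p.2), by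
    have h := 𝒳.shift_mem (g, 1) x.1 x.2
    have e : shift ((g, 1) : G₁ × G₂) x.1 = fun p => x.1 (p.1 * g, p.2) := by
      funext p
      simp [shift, Prod.mul_def]
    rwa [e] at h⟩

/-- The restriction of the metric `configDist` to a subshift. -/
noncomputable def Subshift.dist (𝒳 : Subshift (G₁ × G₂) A) (S₁ : SymmGenSet G₁)
    (S₂ : SymmGenSet G₂) (x y : 𝒳.carrier) : ℝ≥0 :=
  configDist S₁ S₂ x.1 y.1

end Product

/-- `c₁ = limsup_n |ball n| / n`. -/
noncomputable def upperLinearRate {Γ : Type*} [Group Γ] (S : SymmGenSet Γ) : ℝ≥0∞ :=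
  limsup (fun n : ℕ => ((S.ball n).card : ℝ≥0∞) / (n : ℝ≥0∞)) atTop

/-- `c₂ = liminf_n |ball n| / n`. -/
noncomputable def lowerLinearRate {Γ : Type*} [Group Γ] (S : SymmGenSet Γ) : ℝ≥0∞ :=
  liminf (fun n : ℕ => ((S.ball n).card : ℝ≥0∞) / (n : ℝ≥0∞)) atTop

end SubshiftMeanDim

open SubshiftMeanDim

/-! The metric takes only the value zero and powers of 1/2, so being `2⁻¹ ^ k`-close for `d_F` means
agreeing on a window: the elements of length below `k` times `F` in the first coordinate, times the
elements of length below `k` in the second. Covering numbers are therefore exact pattern counts on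
windows (`openCoveringNumber_eq`). Their logarithm is subadditive and translation invariant in `F`,
so the Ornstein–Weiss argument (`IsSubadd.exists_rate`), applied in `G₁` and in `G`, gives the
limits.

Upper bound: for fixed `k` and a very invariant `F`, the window of index `k + 1` is `F × B_k` up to
a negligible part, and carries about `h |F| |B_k|` bits at most (`window_rate_le`). At this scale
`|log ε|` is at least `k`, and `|B_k| / k` is asymptotically at most `c₁`.

Lower bound: over `F = B_N` the windows are the boxes `Q_k = B_{k+N} × B_k`. With `s = c h' |B_N|`,
where `c < c₂` and `h' < h`, a set of diameter about `2⁻¹ ^ (k+1)` costs at least `2 ^ (-h' |Q_k|)`.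
It remains to see that cylinders over boxes cannot cover the subshift at total cost below one
(`one_le_sum_of_cylinder_cover`). If they did, every translate of a configuration would lie in one
of them. A Vitali selection then puts disjoint boxes with prescribed contents on a fixed proportion
of a huge invariant `Ω`. Counting configurations by the positions and labels of the boxes and by the
pattern on the rest gives fewer than `2 ^ ((h - η) |Ω|)` patterns, contradicting entropy `h`. The
boxes are doubling and invariant uniformly in `N`, because doubling balls have negligible spheres
(`eventually_card_annulus_le`).

Finally, covers by sets of small diameter bound Hausdorff sums, so mean Hausdorff dimension is at
most metric mean dimension, and `c₁ = c₂` closes the chain of inequalities. -/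

namespace SubshiftMeanDim

/-! ### Boundaries, almost invariant sets and almost disjoint translates. -/

section Invariance

variable {Γ : Type*} [Group Γ]

/-- The right translate `T c`. -/
def translate (T : Finset Γ) (c : Γ) : Finset Γ := T.map (mulRightEmbedding c)

theorem mem_translate {T : Finset Γ} {c x : Γ} : x ∈ translate T c ↔ x * c⁻¹ ∈ T := by
  simp only [translate, Finset.mem_map, mulRightEmbedding_apply]
  constructor
  · rintro ⟨t, ht, rfl⟩; simpa using ht
  · intro h; exact ⟨_, h, by simp⟩

@[simp] theorem card_translate (T : Finset Γ) (c : Γ) : (translate T c).card = T.card :=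
  Finset.card_map _

open Classical in
/-- The elements of `A` that are moved out of `A` by some element of `K`. -/
noncomputable def innerBdry (K A : Finset Γ) : Finset Γ := A.filter fun a => ∃ k ∈ K, k * a ∉ A

open Classical in
/-- The elements outside `A` that are moved into `A` by some element of `K`. -/
noncomputable def outerBdry (K A : Finset Γ) : Finset Γ :=
  (Finset.image₂ (fun k a => k⁻¹ * a) K A).filter fun b => b ∉ A

theorem mem_innerBdry {K A : Finset Γ} {a : Γ} :
    a ∈ innerBdry K A ↔ a ∈ A ∧ ∃ k ∈ K, k * a ∉ A := by
  simp [innerBdry]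

theorem mem_outerBdry {K A : Finset Γ} {b : Γ} :
    b ∈ outerBdry K A ↔ b ∉ A ∧ ∃ k ∈ K, k * b ∈ A := by
  classical
  simp only [outerBdry, Finset.mem_filter, Finset.mem_image₂]
  constructor
  · rintro ⟨⟨k, hk, a, ha, rfl⟩, h⟩; exact ⟨h, k, hk, by simpa using ha⟩
  · rintro ⟨h, k, hk, ha⟩; exact ⟨⟨k, hk, _, ha, by simp⟩, h⟩

theorem innerBdry_subset (K A : Finset Γ) : innerBdry K A ⊆ A := fun _ h => (mem_innerBdry.1 h).1

theorem innerBdry_mono {K K' : Finset Γ} (h : K ⊆ K') (A : Finset Γ) :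
    innerBdry K A ⊆ innerBdry K' A := fun _ ha => by
  obtain ⟨h1, k, hk, h2⟩ := mem_innerBdry.1 ha
  exact mem_innerBdry.2 ⟨h1, k, h hk, h2⟩

/-- If `k * b` lies in `A` and `b` does not, then `k * b` is an inner boundary point for `k⁻¹`; it
and `k` recover `b`. -/
theorem card_outerBdry_le (K A : Finset Γ) :
    (outerBdry K A).card ≤ K.card * (innerBdry (K.map (Equiv.inv Γ).toEmbedding) A).card := by
  classical
  refine le_trans (Finset.card_le_card (t := Finset.image₂ (fun k a => k⁻¹ * a) K
    (innerBdry (K.map (Equiv.inv Γ).toEmbedding) A)) ?_) (Finset.card_image₂_le _ _ _)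
  intro b hb
  obtain ⟨h, k, hk, ha⟩ := mem_outerBdry.1 hb
  refine Finset.mem_image₂.2
    ⟨k, hk, k * b, mem_innerBdry.2 ⟨ha, k⁻¹, ?_, by simpa using h⟩, by simp⟩
  simpa using hk

/-- Removing tiles creates new boundary only at points which `K` moves into a removed tile. The tile
shape may depend on the centre, as the Vitali tilings below require. -/
theorem card_innerBdry_sdiff_le {K F R C : Finset Γ} {T : Γ → Finset Γ}
    (hR : ∀ x, x ∈ R ↔ x ∈ F ∧ ∀ c ∈ C, x ∉ translate (T c) c) :
    (innerBdry K R).card ≤ (innerBdry K F).card + ∑ c ∈ C, (outerBdry K (T c)).card := by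
  classical
  have : innerBdry K R ⊆ innerBdry K F ∪ C.biUnion fun c => translate (outerBdry K (T c)) c := by
    intro a ha
    obtain ⟨haR, k, hk, hka⟩ := mem_innerBdry.1 ha
    rw [hR] at haR
    by_cases hF : k * a ∈ F
    · rw [hR] at hka
      push Not at hka
      obtain ⟨c, hc, hkc⟩ := hka hF
      refine Finset.mem_union_right _ (Finset.mem_biUnion.2 ⟨c, hc, ?_⟩)
      have h1 := haR.2 c hc
      rw [mem_translate] at h1 hkc ⊢
      exact mem_outerBdry.2 ⟨h1, k, hk, by rwa [← mul_assoc]⟩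
    · exact Finset.mem_union_left _ (mem_innerBdry.2 ⟨haR.1, k, hk, hF⟩)
  refine (Finset.card_le_card this).trans ((Finset.card_union_le _ _).trans ?_)
  gcongr
  refine Finset.card_biUnion_le.trans ?_
  simp

/-- The inner `K`-boundary of `A` has proportion at most `δ`. -/
def IsInvariant (K : Finset Γ) (δ : ℝ) (A : Finset Γ) : Prop :=
  ((innerBdry K A).card : ℝ) ≤ δ * A.card

theorem IsInvariant.mono {K K' : Finset Γ} {δ δ' : ℝ} {A : Finset Γ} (h : IsInvariant K' δ' A)
    (hK : K ⊆ K') (hδ : δ' ≤ δ) : IsInvariant K δ A := by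
  unfold IsInvariant at *
  have : ((innerBdry K A).card : ℝ) ≤ (innerBdry K' A).card := by
    exact_mod_cast Finset.card_le_card (innerBdry_mono hK A)
  nlinarith [(Nat.cast_nonneg A.card : (0:ℝ) ≤ _)]

theorem IsFolnerSeq.eventually_isInvariant {F : ℕ → Finset Γ} (hF : IsFolnerSeq F) (K : Finset Γ)
    {δ : ℝ} (hδ : 0 < δ) : ∀ᶠ n in atTop, IsInvariant K δ (F n) := by
  classical
  rcases K.eq_empty_or_nonempty with rfl | hK
  · refine Eventually.of_forall fun n => ?_
    have : innerBdry ∅ (F n) = ∅ := by ext; simp [mem_innerBdry]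
    simp only [IsInvariant, this]; simp; positivity
  have hc : (0 : ℝ) < K.card := by exact_mod_cast hK.card_pos
  filter_upwards [hF.2 K hK (δ / K.card) (by positivity)] with n hn
  have hsub : innerBdry K (F n) ⊆
      Finset.image₂ (fun k a => k⁻¹ * a) K ((K * F n) \ F n) := by
    intro a ha
    obtain ⟨ha, k, hk, hka⟩ := mem_innerBdry.1 ha
    exact Finset.mem_image₂.2 ⟨k, hk, k * a,
      Finset.mem_sdiff.2 ⟨Finset.mul_mem_mul hk ha, hka⟩, by simp⟩
  have h1 : (innerBdry K (F n)).card ≤ K.card * ((K * F n) \ F n).card :=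
    (Finset.card_le_card hsub).trans (Finset.card_image₂_le _ _ _)
  have h2 : ((K * F n) \ F n).card ≤ (((K : Set Γ) * (F n : Set Γ)) ∆ (F n : Set Γ)).ncard := by
    rw [← Finset.coe_mul, ← Finset.coe_symmDiff, Set.ncard_coe_finset]
    exact Finset.card_le_card (by rw [symmDiff_def]; exact Finset.subset_union_left)
  have h3 : ((innerBdry K (F n)).card : ℝ) ≤
      K.card * ((((K : Set Γ) * (F n : Set Γ)) ∆ (F n : Set Γ)).ncard : ℝ) := by
    exact_mod_cast h1.trans (Nat.mul_le_mul_left _ h2)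
  unfold IsInvariant
  calc _ ≤ _ := h3
    _ ≤ K.card * (δ / K.card * (F n).card) := by gcongr
    _ = _ := by field_simp

/-- A family of right translates of `T` inside `F` that overlap little and fill a definite
proportion of `F`. -/
theorem exists_almost_disjoint_translates {T : Finset Γ} (hT : T.Nonempty) {e : ℝ} (he : e ≤ 1)
    (F : Finset Γ) :
    ∃ C U : Finset Γ, (∀ x, x ∈ U ↔ ∃ c ∈ C, x ∈ translate T c) ∧ U ⊆ F ∧
      (1 - e) * (C.card * T.card) ≤ U.card ∧
      e * (F.card - (innerBdry T F).card) ≤ U.card := by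
  classical
  let I := F \ innerBdry T F
  let u : Finset Γ → Finset Γ := fun C => C.biUnion (translate T)
  -- A largest set of centres whose translates stay inside `F` and have small total overlap.
  obtain ⟨C, hC, hmax⟩ := Finset.exists_max_image
    (I.powerset.filter fun C => (1 - e) * (C.card * T.card) ≤ ((u C).card : ℝ)) Finset.card
    ⟨∅, by simp [u]⟩
  simp only [Finset.mem_filter, Finset.mem_powerset] at hC hmax
  have hTpos : (0 : ℝ) < T.card := by exact_mod_cast hT.card_pos
  have hIF : ∀ c ∈ I, translate T c ⊆ F := by
    intro c hc x hx
    rw [mem_translate] at hx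
    simp only [I, Finset.mem_sdiff, mem_innerBdry, not_and, not_exists, not_not] at hc
    simpa using hc.2 hc.1 _ hx
  refine ⟨C, u C, by simp [u], Finset.biUnion_subset.2 fun c hc => hIF c (hC.1 hc), hC.2, ?_⟩
  -- By maximality: a translate meeting the union in less than `e |T|` points could be added.
  have hbig : ∀ c ∈ I, e * T.card ≤ ((translate T c ∩ u C).card : ℝ) := by
    intro c hc
    by_cases hcC : c ∈ C
    · rw [Finset.inter_eq_left.2 (Finset.subset_biUnion_of_mem (translate T) hcC), card_translate]
      nlinarith
    · by_contra! hlt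
      have hsplit : ((translate T c \ u C).card : ℝ) + (translate T c ∩ u C).card = T.card := by
        exact_mod_cast (Finset.card_sdiff_add_card_inter _ _).trans (card_translate T c)
      have hu : u (insert c C) = (translate T c \ u C) ∪ u C := by
        simp [u, Finset.biUnion_insert]
      have hcard : ((u (insert c C)).card : ℝ) = (translate T c \ u C).card + (u C).card := by
        rw [hu]; exact_mod_cast Finset.card_union_of_disjoint Finset.sdiff_disjoint
      have := hmax (insert c C) ⟨Finset.insert_subset hc hC.1, by
        rw [hcard, Finset.card_insert_of_notMem hcC]; push_cast; nlinarith [hC.2]⟩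
      rw [Finset.card_insert_of_notMem hcC] at this
      omega
  -- Double counting: a point lies in at most `|T|` translates of `T`.
  have hcount : ∑ c ∈ I, ((translate T c ∩ u C).card : ℝ) ≤ (u C).card * T.card := by
    have : ∑ c ∈ I, (translate T c ∩ u C).card ≤ (u C).card * T.card := by
      have h1 : ∀ c, (translate T c ∩ u C).card = ∑ x ∈ u C, if x * c⁻¹ ∈ T then 1 else 0 := by
        intro c
        rw [← Finset.card_filter]
        congr 1
        ext x
        simp [mem_translate, and_comm]
      simp_rw [h1]
      rw [Finset.sum_comm]
      refine (Finset.sum_le_card_nsmul _ _ T.card fun x _ => ?_).trans (by simp)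
      rw [← Finset.card_filter]
      refine Finset.card_le_card_of_injOn (fun c => x * c⁻¹) (fun c hc => ?_) ?_
      · simp at hc; simpa using hc.2
      · intro a _ b _ h; simpa using h
    exact_mod_cast this
  have hI : (I.card : ℝ) = F.card - (innerBdry T F).card := by
    rw [Finset.cast_card_sdiff (innerBdry_subset T F)]
  have h2 : (I.card : ℝ) * (e * T.card) ≤ ∑ c ∈ I, ((translate T c ∩ u C).card : ℝ) := by
    have := Finset.card_nsmul_le_sum I _ _ hbig
    simpa using this
  rw [← hI]
  have : (e * I.card) * T.card ≤ (u C).card * T.card := by linarith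
  exact le_of_mul_le_mul_right this hTpos

end Invariance

/-! ### The Ornstein–Weiss convergence theorem. -/

section Subadditive

variable {Γ : Type*} [Group Γ]

/-- A monotone, subadditive and right-invariant function of finite subsets of a group. -/
structure IsSubadd (φ : Finset Γ → ℝ) : Prop where
  nonneg : ∀ A, 0 ≤ φ A
  empty : φ ∅ = 0
  le_add : ∀ A B C : Finset Γ, (∀ x ∈ C, x ∈ A ∨ x ∈ B) → φ C ≤ φ A + φ B
  translate : ∀ A c, φ (translate A c) = φ A

namespace IsSubadd

variable {φ : Finset Γ → ℝ} (hφ : IsSubadd φ)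
include hφ

theorem mono {A B : Finset Γ} (h : A ⊆ B) : φ A ≤ φ B := by
  simpa [hφ.empty] using hφ.le_add B ∅ A fun x hx => Or.inl (h hx)

theorem le_sum {ι : Type*} (C : Finset ι) (f : ι → Finset Γ) (U : Finset Γ)
    (hU : ∀ x ∈ U, ∃ c ∈ C, x ∈ f c) : φ U ≤ ∑ c ∈ C, φ (f c) := by
  classical
  induction C using Finset.induction_on generalizing U with
  | empty =>
    have : U = ∅ := Finset.eq_empty_of_forall_notMem fun x hx => by simpa using hU x hx
    simp [this, hφ.empty]
  | insert c C hc ih =>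
    rw [Finset.sum_insert hc]
    refine (hφ.le_add (f c) (U \ f c) U fun x hx => ?_).trans (add_le_add_right (ih _ ?_) _)
    · by_cases h : x ∈ f c <;> simp [h, hx]
    · intro x hx
      obtain ⟨hxU, hxc⟩ := Finset.mem_sdiff.1 hx
      obtain ⟨c', hc', h⟩ := hU x hxU
      rcases Finset.mem_insert.1 hc' with rfl | h'
      · exact absurd h hxc
      · exact ⟨c', h', h⟩

theorem le_card_mul (A : Finset Γ) : φ A ≤ φ {1} * A.card := by
  refine (hφ.le_sum A (SubshiftMeanDim.translate {1}) A fun x hx =>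
    ⟨x, hx, by simp [mem_translate]⟩).trans ?_
  simp [hφ.translate, mul_comm]

end IsSubadd

/-- `L` is an asymptotic upper bound of `φ A / |A|` for increasingly invariant `A`. -/
def IsUpperRate (φ : Finset Γ → ℝ) (L : ℝ) : Prop :=
  ∀ η : ℝ, 0 < η → ∃ K : Finset Γ, ∃ δ : ℝ, 0 < δ ∧
    ∀ A, IsInvariant K δ A → φ A ≤ (L + η) * A.card

/-- `L` is an asymptotic lower bound of `φ A / |A|` for increasingly invariant `A`. -/
def IsLowerRate (φ : Finset Γ → ℝ) (L : ℝ) : Prop :=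
  ∀ η : ℝ, 0 < η → ∃ K : Finset Γ, ∃ δ : ℝ, 0 < δ ∧
    ∀ A, IsInvariant K δ A → (L - η) * A.card ≤ φ A

/-- An upper rate also controls subsets with small boundary relative to an ambient set. -/
theorem IsUpperRate.relative {φ : Finset Γ → ℝ} {L : ℝ} (hL : IsUpperRate φ L) (hφ : IsSubadd φ)
    (hL0 : 0 ≤ L) {η : ℝ} (hη : 0 < η) :
    ∃ K : Finset Γ, ∃ δ : ℝ, 0 < δ ∧ ∀ F R : Finset Γ,
      ((innerBdry K R).card : ℝ) ≤ δ * F.card → φ R ≤ (L + η) * R.card + η * F.card := by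
  obtain ⟨K, δ, hδ, h⟩ := hL η hη
  have hM : 0 ≤ φ {1} := hφ.nonneg _
  refine ⟨K, δ * (η / (φ {1} + 1)), by positivity, fun F R hR => ?_⟩
  -- Either `R` is invariant itself, or it is so small compared with `F` that the linear bound by `φ
  -- {1}` suffices; `φ {1} + 1` avoids dividing by zero.
  by_cases hinv : IsInvariant K δ R
  · have := h R hinv
    have : 0 ≤ η * F.card := by positivity
    linarith
  · have h1 : δ * R.card < δ * (η / (φ {1} + 1)) * F.card := (not_le.1 hinv).trans_le hR
    have h2 : (R.card : ℝ) ≤ η / (φ {1} + 1) * F.card := by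
      rw [mul_assoc] at h1; exact (lt_of_mul_lt_mul_left h1 hδ.le).le
    have h3 := hφ.le_card_mul R
    have h4 : φ {1} * (R.card : ℝ) ≤ η * F.card := by
      calc φ {1} * (R.card : ℝ) ≤ (φ {1} + 1) * (η / (φ {1} + 1) * F.card) := by gcongr; linarith
        _ = η * F.card := by field_simp
    have : 0 ≤ (L + η) * R.card := by positivity
    linarith

/-- Cheap tiles lower an upper rate: almost disjoint translates of one cheap `T` fill at least the
proportion `e / 2` of `F`, at a rate below `L`. What remains still has small boundary relative to
`F`, so `L` is nearly valid there. -/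
theorem IsUpperRate.improve {φ : Finset Γ → ℝ} {L l : ℝ} (hL : IsUpperRate φ L) (hφ : IsSubadd φ)
    (hl : 0 ≤ l) (hlL : l < L)
    (htile : ∀ (K : Finset Γ) (δ : ℝ), 0 < δ →
      ∃ T : Finset Γ, T.Nonempty ∧ IsInvariant K δ T ∧ φ T ≤ l * T.card) :
    ∃ κ : ℝ, 0 < κ ∧ IsUpperRate φ (L - κ) := by
  classical
  -- The overlap `e` is so small that the loss factor `1 / (1 - e)` raises `l` at most to the
  -- midpoint of `l` and `L`.
  obtain ⟨e, he0, he1, hel⟩ : ∃ e : ℝ, 0 < e ∧ e ≤ 1 / 2 ∧ l ≤ (1 - e) * ((l + L) / 2) := by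
    have hpos : 0 < l + L := by linarith
    refine ⟨(L - l) / (l + L) / 2, by have := sub_pos.2 hlL; positivity, ?_, ?_⟩
    · have : (L - l) / (l + L) ≤ 1 := by rw [div_le_one hpos]; linarith
      linarith
    · have : (1 - (L - l) / (l + L) / 2) * ((l + L) / 2) = (l + L) / 2 - (L - l) / 4 := by
        field_simp
        ring
      rw [this]; linarith
  set γ := L - l with hγ
  have hγ0 : 0 < γ := sub_pos.2 hlL
  set η := e * γ / 32 with hη
  have hη0 : 0 < η := by positivity
  obtain ⟨K, δ, hδ, hrel⟩ := hL.relative hφ (hl.trans hlL.le) hη0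
  set K' := K.map (Equiv.inv Γ).toEmbedding with hK'
  obtain ⟨T, hTne, hTinv, hTφ⟩ := htile K' (δ / (4 * (K.card + 1))) (by positivity)
  have hTpos : (0 : ℝ) < T.card := by exact_mod_cast hTne.card_pos
  refine ⟨e * γ / 16, by positivity, fun ζ hζ => ⟨K ∪ T, min (δ / 2) (1 / 2), by positivity,
    fun F hF => ?_⟩⟩
  have hF0 : (0 : ℝ) ≤ F.card := Nat.cast_nonneg _
  obtain ⟨C, U, hU, hUF, hdisj, hcov⟩ :=
    exists_almost_disjoint_translates hTne (by linarith : e ≤ 1) F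
  have hFT : ((innerBdry T F).card : ℝ) ≤ 1 / 2 * F.card :=
    hF.mono Finset.subset_union_right (min_le_right _ _)
  have hFK : ((innerBdry K F).card : ℝ) ≤ δ / 2 * F.card :=
    hF.mono Finset.subset_union_left (min_le_left _ _)
  have hUle : (U.card : ℝ) ≤ F.card := by exact_mod_cast Finset.card_le_card hUF
  have hUbig : e / 2 * F.card ≤ U.card := by nlinarith
  have hCT : (C.card * T.card : ℝ) ≤ 2 * F.card := by
    have : (0:ℝ) ≤ C.card * T.card := by positivity
    nlinarith
  have hout : ((outerBdry K T).card : ℝ) ≤ δ / 4 * T.card := by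
    have h1 : ((outerBdry K T).card : ℝ) ≤ K.card * (innerBdry K' T).card := by
      exact_mod_cast card_outerBdry_le K T
    have h2 : (K.card : ℝ) * (innerBdry K' T).card ≤
        (K.card + 1) * (δ / (4 * (K.card + 1)) * T.card) :=
      mul_le_mul (by linarith) hTinv (by positivity) (by positivity)
    refine h1.trans (h2.trans (le_of_eq ?_))
    field_simp
  have hRb : ((innerBdry K (F \ U)).card : ℝ) ≤ δ * F.card := by
    have h1 : ((innerBdry K (F \ U)).card : ℝ) ≤
        (innerBdry K F).card + C.card * (outerBdry K T).card := by
      have := card_innerBdry_sdiff_le (K := K) (F := F) (R := F \ U) (C := C) (T := fun _ => T)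
        (fun x => by rw [Finset.mem_sdiff, hU]; simp)
      rw [Finset.sum_const, smul_eq_mul] at this
      exact_mod_cast this
    have h2 : (C.card : ℝ) * (outerBdry K T).card ≤ δ / 4 * (C.card * T.card) := by
      calc (C.card : ℝ) * (outerBdry K T).card ≤ C.card * (δ / 4 * T.card) := by gcongr
        _ = _ := by ring
    nlinarith
  have hφR := hrel F (F \ U) hRb
  have hφU : φ U ≤ U.card * ((l + L) / 2) := by
    have h1 : φ U ≤ C.card * φ T := by
      simpa [hφ.translate] using hφ.le_sum C (translate T) U fun x hx => (hU x).1 hx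
    calc φ U ≤ C.card * φ T := h1
      _ ≤ C.card * (l * T.card) := by gcongr
      _ ≤ C.card * (((1 - e) * ((l + L) / 2)) * T.card) := by gcongr
      _ = (1 - e) * (C.card * T.card) * ((l + L) / 2) := by ring
      _ ≤ _ := by
        have : 0 ≤ (l + L) / 2 := by linarith
        gcongr
  have hφF : φ F ≤ φ U + φ (F \ U) :=
    hφ.le_add _ _ _ fun x hx => by by_cases h : x ∈ U <;> simp [h, hx]
  have hRc : ((F \ U).card : ℝ) = F.card - U.card := Finset.cast_card_sdiff hUF
  rw [hRc] at hφR
  have hl2 : (l + L) / 2 = L - γ / 2 := by rw [hγ]; ring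
  rw [hl2] at hφU
  have h5 : γ / 2 * (e / 2 * F.card) ≤ γ / 2 * U.card := by gcongr
  have h6 : 0 ≤ η * U.card := by positivity
  have h7 : 0 ≤ ζ * F.card := by positivity
  have h8 : η * F.card = e * γ / 32 * F.card := by rw [hη]
  nlinarith

/-- **Ornstein–Weiss**: in a group with arbitrarily invariant finite sets, the averages of a
monotone subadditive right-invariant function converge. -/
theorem IsSubadd.exists_rate {φ : Finset Γ → ℝ} (hφ : IsSubadd φ)
    (hΓ : ∀ (K : Finset Γ) (δ : ℝ), 0 < δ → ∃ T : Finset Γ, T.Nonempty ∧ IsInvariant K δ T) :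
    ∃ h : ℝ, 0 ≤ h ∧ IsUpperRate φ h ∧ IsLowerRate φ h := by
  have hne : {L | IsUpperRate φ L}.Nonempty := ⟨φ {1}, fun η hη => ⟨∅, 1, one_pos, fun A _ => by
    have := hφ.le_card_mul A
    have : 0 ≤ η * A.card := by positivity
    linarith⟩⟩
  have hnn : ∀ L, IsUpperRate φ L → 0 ≤ L := by
    intro L hL
    refine le_of_forall_pos_le_add fun η hη => ?_
    obtain ⟨K, δ, hδ, h⟩ := hL η hη
    obtain ⟨T, hT, hinv⟩ := hΓ K δ hδ
    have hTpos : (0 : ℝ) < T.card := by exact_mod_cast hT.card_pos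
    have h1 := (hφ.nonneg T).trans (h T hinv)
    by_contra! hlt
    nlinarith
  have hbdd : BddBelow {L | IsUpperRate φ L} := ⟨0, fun L hL => hnn L hL⟩
  have hup : IsUpperRate φ (sInf {L | IsUpperRate φ L}) := by
    intro η hη
    obtain ⟨L, hL, hlt⟩ := exists_lt_of_csInf_lt hne
      (lt_add_of_pos_right (sInf {L | IsUpperRate φ L}) (half_pos hη))
    obtain ⟨K, δ, hδ, h⟩ := hL (η / 2) (half_pos hη)
    exact ⟨K, δ, hδ, fun A hA => (h A hA).trans
      (mul_le_mul_of_nonneg_right (by linarith) (Nat.cast_nonneg _))⟩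
  refine ⟨_, hnn _ hup, hup, fun η hη => ?_⟩
  by_contra! hcon
  set h := sInf {L | IsUpperRate φ L} with hh
  -- Failure of the lower rate at `η` supplies arbitrarily invariant tiles of rate below `h - η`,
  -- contradicting the choice of `h` as an infimum.
  obtain ⟨κ, hκ, hlow⟩ := hup.improve hφ (l := h - η) (by
      obtain ⟨T, -, hT⟩ := hcon ∅ 1 one_pos
      by_contra! hneg
      have := hφ.nonneg T
      have : (h - η) * T.card ≤ 0 := mul_nonpos_of_nonpos_of_nonneg hneg.le (Nat.cast_nonneg _)
      linarith) (by linarith) (fun K δ hδ => by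
      obtain ⟨T, hinv, hT⟩ := hcon K δ hδ
      refine ⟨T, ?_, hinv, hT.le⟩
      rw [Finset.nonempty_iff_ne_empty]
      rintro rfl
      simp [hφ.empty] at hT)
  have := csInf_le hbdd (a := h - κ) hlow
  linarith

/-- Convergence of averages along a Følner sequence. -/
theorem IsUpperRate.tendsto {φ : Finset Γ → ℝ} {h : ℝ} (hu : IsUpperRate φ h)
    (hl : IsLowerRate φ h) {F : ℕ → Finset Γ} (hF : IsFolnerSeq F) :
    Tendsto (fun n => φ (F n) / (F n).card) atTop (𝓝 h) := by
  rw [Metric.tendsto_nhds]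
  intro ε hε
  obtain ⟨K, δ, hδ, h1⟩ := hu (ε / 2) (half_pos hε)
  obtain ⟨K', δ', hδ', h2⟩ := hl (ε / 2) (half_pos hε)
  filter_upwards [hF.eventually_isInvariant K hδ, hF.eventually_isInvariant K' hδ'] with n hn hn'
  have hpos : (0 : ℝ) < (F n).card := by exact_mod_cast (hF.1 n).card_pos
  have a := (div_le_iff₀ hpos).2 (h1 _ hn)
  have b := (le_div_iff₀ hpos).2 (h2 _ hn')
  rw [Real.dist_eq, abs_lt]
  constructor <;> linarith

end Subadditive

/-! ### Word length, balls, and growth independent of the generating set. -/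

namespace SymmGenSet

variable {Γ : Type*} [Group Γ] (S : SymmGenSet Γ)

theorem mem_ball {n : ℕ} {g : Γ} : g ∈ S.ball n ↔ S.wordLength g ≤ n := by
  simp [ball]

theorem wordLength_prod_le {l : List Γ} (hl : ∀ s ∈ l, s ∈ S.carrier) :
    S.wordLength l.prod ≤ l.length :=
  Nat.sInf_le ⟨l, rfl, hl, rfl⟩

@[simp] theorem wordLength_one : S.wordLength 1 = 0 :=
  Nat.le_zero.1 (S.wordLength_prod_le (l := []) (by simp))

theorem wordLength_mul_le (g h : Γ) : S.wordLength (g * h) ≤ S.wordLength g + S.wordLength h := by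
  obtain ⟨l, hl, hm, rfl⟩ := S.exists_list_length_eq g
  obtain ⟨l', hl', hm', rfl⟩ := S.exists_list_length_eq h
  rw [← hl, ← hl', ← List.prod_append, ← List.length_append]
  refine S.wordLength_prod_le fun s hs => ?_
  rcases List.mem_append.1 hs with h | h
  exacts [hm s h, hm' s h]

theorem wordLength_inv_le (g : Γ) : S.wordLength g⁻¹ ≤ S.wordLength g := by
  obtain ⟨l, hl, hm, rfl⟩ := S.exists_list_length_eq g
  rw [← hl, List.prod_inv_reverse]
  refine (S.wordLength_prod_le fun s hs => ?_).trans (by simp)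
  simp only [List.mem_reverse, List.mem_map] at hs
  obtain ⟨t, ht, rfl⟩ := hs
  exact S.inv_mem t (hm t ht)

@[simp] theorem wordLength_inv (g : Γ) : S.wordLength g⁻¹ = S.wordLength g :=
  le_antisymm (S.wordLength_inv_le g) (by simpa using S.wordLength_inv_le g⁻¹)

/-- Cutting a geodesic word after `m` letters. -/
theorem exists_mul_eq {g : Γ} {m : ℕ} (hm : m ≤ S.wordLength g) :
    ∃ y z, y * z = g ∧ S.wordLength y = m ∧ S.wordLength z = S.wordLength g - m := by
  obtain ⟨l, hl, hmem, hp⟩ := S.exists_list_length_eq g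
  have h1 : S.wordLength (l.take m).prod ≤ m :=
    (S.wordLength_prod_le fun s hs => hmem s (List.mem_of_mem_take hs)).trans (by simp)
  have h2 : S.wordLength (l.drop m).prod ≤ S.wordLength g - m :=
    (S.wordLength_prod_le fun s hs => hmem s (List.mem_of_mem_drop hs)).trans (by simp [hl])
  have h3 : (l.take m).prod * (l.drop m).prod = g := by rw [List.prod_take_mul_prod_drop, hp]
  have h4 := S.wordLength_mul_le (l.take m).prod (l.drop m).prod
  rw [h3] at h4
  exact ⟨_, _, h3, by omega, by omega⟩

theorem one_mem_ball (n : ℕ) : (1 : Γ) ∈ S.ball n := by simp [mem_ball]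

theorem ball_nonempty (n : ℕ) : (S.ball n).Nonempty := ⟨1, S.one_mem_ball n⟩

theorem card_ball_pos (n : ℕ) : 0 < (S.ball n).card := (S.ball_nonempty n).card_pos

theorem ball_mono : Monotone S.ball := fun _ _ h _ hg => S.mem_ball.2 ((S.mem_ball.1 hg).trans h)

theorem subset_ball (K : Finset Γ) : ∃ r, K ⊆ S.ball r :=
  ⟨K.sup S.wordLength, fun _ hk => S.mem_ball.2 (Finset.le_sup hk)⟩

theorem mul_mem_ball {g h : Γ} {m n : ℕ} (hg : g ∈ S.ball m) (hh : h ∈ S.ball n) :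
    g * h ∈ S.ball (m + n) :=
  S.mem_ball.2 ((S.wordLength_mul_le g h).trans (add_le_add (S.mem_ball.1 hg) (S.mem_ball.1 hh)))

theorem exists_mul_eq_of_mem_ball_add {g : Γ} {m n : ℕ} (hg : g ∈ S.ball (m + n)) :
    ∃ y ∈ S.ball m, ∃ z ∈ S.ball n, y * z = g := by
  rw [mem_ball] at hg
  obtain ⟨y, z, h, hy, hz⟩ := S.exists_mul_eq (min_le_right m (S.wordLength g))
  exact ⟨y, S.mem_ball.2 (by omega), z, S.mem_ball.2 (by omega), h⟩

theorem wordLength_le_mul (S' : SymmGenSet Γ) {m : ℕ} (hm : S.carrier ⊆ S'.ball m) (g : Γ) :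
    S'.wordLength g ≤ m * S.wordLength g := by
  obtain ⟨l, hl, hmem, rfl⟩ := S.exists_list_length_eq g
  rw [← hl]
  clear hl
  induction l with
  | nil => simp
  | cons a l ih =>
    rw [List.prod_cons, List.length_cons, mul_add, mul_one, add_comm]
    exact (S'.wordLength_mul_le _ _).trans (add_le_add
      (S'.mem_ball.1 (hm (hmem a (by simp)))) (ih fun s hs => hmem s (by simp [hs])))

theorem exists_ball_subset_ball_mul (S' : SymmGenSet Γ) :
    ∃ m : ℕ, 1 ≤ m ∧ ∀ n, S.ball n ⊆ S'.ball (m * n) := by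
  obtain ⟨m, hm⟩ := S'.subset_ball S.carrier
  refine ⟨m + 1, by omega, fun n g hg => S'.mem_ball.2 ?_⟩
  exact (S.wordLength_le_mul S' (hm.trans (S'.ball_mono (Nat.le_succ m))) g).trans
    (Nat.mul_le_mul_left _ (S.mem_ball.1 hg))

end SymmGenSet

/-- Polynomial growth does not depend on the generating set. -/
theorem HasPolynomialGrowth.bounds {Γ : Type*} [Group Γ] {d : ℝ} (h : HasPolynomialGrowth Γ d)
    (S : SymmGenSet Γ) : ∃ a b : ℝ, 0 < a ∧ 0 < b ∧ ∀ n : ℕ, 1 ≤ n →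
      a * (n : ℝ) ^ d ≤ ((S.ball n).card : ℝ) ∧ ((S.ball n).card : ℝ) ≤ b * (n : ℝ) ^ d := by
  obtain ⟨hd, S', a, b, ha, hb, hab⟩ := h
  obtain ⟨m, hm, hS⟩ := S.exists_ball_subset_ball_mul S'
  obtain ⟨m', hm', hS'⟩ := S'.exists_ball_subset_ball_mul S
  have hm0 : (0 : ℝ) < m := by exact_mod_cast hm
  have hm0' : (0 : ℝ) < m' := by exact_mod_cast hm'
  refine ⟨min (a / (2 * m') ^ d) (1 / m' ^ d), b * m ^ d, by positivity, by positivity,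
    fun n hn => ⟨?_, ?_⟩⟩
  · have hn0 : (0 : ℝ) < n := by exact_mod_cast hn
    -- Small radii use only that a ball is nonempty; for the others, rounding `n / m'` down loses at
    -- most a factor two.
    rcases lt_or_ge n m' with hlt | hge
    · have h1 : (1 : ℝ) ≤ (S.ball n).card := by exact_mod_cast S.card_ball_pos n
      refine le_trans ?_ h1
      calc min (a / (2 * m') ^ d) (1 / m' ^ d) * (n : ℝ) ^ d ≤ 1 / m' ^ d * (m' : ℝ) ^ d := by
            gcongr
            exact min_le_right _ _
        _ = 1 := by field_simp
    · have hq : 1 ≤ n / m' := Nat.div_pos hge (by omega)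
      have h1 : ((S'.ball (n / m')).card : ℝ) ≤ (S.ball n).card := by
        exact_mod_cast Finset.card_le_card ((hS' _).trans (S.ball_mono (Nat.mul_div_le n m')))
      have h2 : (n : ℝ) ≤ 2 * m' * (n / m' : ℕ) := by
        have h3 := Nat.div_add_mod n m'
        have h4 := Nat.mod_lt n (by omega : m' > 0)
        have h5 : n ≤ 2 * m' * (n / m') := by nlinarith
        exact_mod_cast h5
      calc min (a / (2 * m') ^ d) (1 / m' ^ d) * (n : ℝ) ^ d
          ≤ a / (2 * m') ^ d * (2 * m' * (n / m' : ℕ) : ℝ) ^ d := by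
            gcongr
            exact min_le_left _ _
        _ = a * ((n / m' : ℕ) : ℝ) ^ d := by
            rw [Real.mul_rpow (x := 2 * (m' : ℝ)) (by positivity) (by positivity), ← mul_assoc,
              div_mul_cancel₀ _ (by positivity)]
        _ ≤ _ := (hab _ hq).1.trans h1
  · calc ((S.ball n).card : ℝ) ≤ (S'.ball (m * n)).card := by
          exact_mod_cast Finset.card_le_card (hS n)
      _ ≤ b * ((m * n : ℕ) : ℝ) ^ d := (hab _ (Nat.mul_pos hm hn)).2
      _ = _ := by push_cast; rw [Real.mul_rpow (by positivity) (by positivity), mul_assoc]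

theorem HasPolynomialGrowth.doubling {Γ : Type*} [Group Γ] {d : ℝ} (h : HasPolynomialGrowth Γ d)
    (S : SymmGenSet Γ) : ∃ D : ℕ, 1 ≤ D ∧ ∀ n, (S.ball (2 * n)).card ≤ D * (S.ball n).card := by
  obtain ⟨a, b, ha, hb, hab⟩ := h.bounds S
  refine ⟨⌈b * 2 ^ d / a⌉₊ + 1, by omega, fun n => ?_⟩
  rcases Nat.eq_zero_or_pos n with rfl | hn
  · exact Nat.le_mul_of_pos_left _ (by omega)
  have h1 : ((S.ball (2 * n)).card : ℝ) ≤ b * 2 ^ d / a * (S.ball n).card := by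
    calc ((S.ball (2 * n)).card : ℝ) ≤ b * ((2 * n : ℕ) : ℝ) ^ d := (hab _ (by omega)).2
      _ = b * 2 ^ d / a * (a * (n : ℝ) ^ d) := by
        push_cast
        rw [Real.mul_rpow (by positivity) (by positivity)]
        field_simp
      _ ≤ _ := by gcongr; exact (hab n hn).1
  have h2 : ((S.ball (2 * n)).card : ℝ) ≤ ((⌈b * 2 ^ d / a⌉₊ + 1 : ℕ) : ℝ) * (S.ball n).card := by
    refine h1.trans ?_
    gcongr
    exact (Nat.le_ceil _).trans (by push_cast; linarith)
  exact_mod_cast h2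

/-! ### Vitali selection and the Følner property of doubling balls. -/

/-- Vitali selection: a disjoint subfamily meeting every member in one of no smaller rank. -/
theorem exists_disjoint_subfamily {ι Γ : Type*} (I : Finset ι) (t : ι → Finset Γ) (r : ι → ℕ)
    (ht : ∀ i ∈ I, (t i).Nonempty) :
    ∃ C ⊆ I, (C : Set ι).PairwiseDisjoint t ∧
      ∀ i ∈ I, ∃ c ∈ C, r i ≤ r c ∧ ∃ x, x ∈ t i ∧ x ∈ t c := by
  classical
  -- With sizes `2 ^ r` and a ratio below two, being comparable forces the integer ranks to be
  -- ordered exactly.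
  obtain ⟨u, hu, hdisj, hcov⟩ := Vitali.exists_disjoint_subfamily_covering_enlargement
    (fun i => (t i : Set Γ)) (I : Set ι) (fun i => (2 : ℝ) ^ r i) (3 / 2) (by norm_num)
    (fun _ _ => by positivity) (2 ^ I.sup r)
    (fun i hi => pow_le_pow_right₀ (by norm_num) (Finset.le_sup hi))
    (fun i hi => ht i hi)
  refine ⟨I.filter (· ∈ u), Finset.filter_subset _ _, ?_, fun i hi => ?_⟩
  · intro a ha b hb hab
    have := hdisj (by simpa using (Finset.mem_filter.1 ha).2) (Finset.mem_filter.1 hb).2 hab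
    exact Finset.disjoint_coe.1 this
  · obtain ⟨b, hb, ⟨x, hx, hx'⟩, hle⟩ := hcov i hi
    refine ⟨b, Finset.mem_filter.2 ⟨hu hb, hb⟩, ?_, x, hx, hx'⟩
    by_contra! hlt
    have h1 : (2 : ℝ) ^ (r b + 1) ≤ 2 ^ r i := pow_le_pow_right₀ (by norm_num) hlt
    rw [pow_succ] at h1
    have : (0 : ℝ) < 2 ^ r b := by positivity
    linarith

namespace SymmGenSet

variable {Γ : Type*} [Group Γ] (S : SymmGenSet Γ)

/-- A geodesic from the identity to a point of the outer shell passes, `2 h` before its end, through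
a centre whose `h`-ball lies in the inner shell. Vitali selection among these balls leaves disjoint
ones whose concentric `4 h`-balls cover the outer shell, and doubling is applied twice. -/
theorem card_annulus_le {D : ℕ} (hD : ∀ n, (S.ball (2 * n)).card ≤ D * (S.ball n).card)
    {n h : ℕ} (hh : 1 ≤ h) (hn : 4 * h ≤ n) :
    (S.ball n).card - (S.ball (n - h)).card ≤
      D ^ 2 * ((S.ball (n - h)).card - (S.ball (n - 4 * h)).card) := by
  classical
  rw [← Finset.card_sdiff_of_subset (S.ball_mono (Nat.sub_le n h)),
    ← Finset.card_sdiff_of_subset (S.ball_mono (by omega : n - 4 * h ≤ n - h))]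
  have hball4 : (S.ball (4 * h)).card ≤ D ^ 2 * (S.ball h).card := by
    have h1 := hD (2 * h)
    have h2 := Nat.mul_le_mul_left D (hD h)
    rw [show 2 * (2 * h) = 4 * h by ring] at h1
    calc _ ≤ _ := h1
      _ ≤ _ := h2
      _ = _ := by ring
  have hmem : ∀ x ∈ S.ball n \ S.ball (n - h), ∃ y, y⁻¹ * x ∈ S.ball (2 * h) ∧
      n - 3 * h < S.wordLength y ∧ S.wordLength y ≤ n - 2 * h := by
    intro x hx
    simp only [Finset.mem_sdiff, mem_ball, not_le] at hx
    obtain ⟨y, z, rfl, hy, hz⟩ := S.exists_mul_eq (g := x) (m := S.wordLength x - 2 * h) (by omega)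
    refine ⟨y, ?_, by omega, by omega⟩
    rw [inv_mul_cancel_left, mem_ball]; omega
  choose! y hy hy1 hy2 using hmem
  set I := S.ball n \ S.ball (n - h) with hI
  let t : Γ → Finset Γ := fun x => (S.ball h).map (mulLeftEmbedding (y x))
  have ht : ∀ x g, g ∈ t x ↔ (y x)⁻¹ * g ∈ S.ball h := by
    intro x g
    simp only [t, Finset.mem_map, mulLeftEmbedding_apply]
    exact ⟨by rintro ⟨a, ha, rfl⟩; simpa using ha, fun h => ⟨_, h, by simp⟩⟩
  obtain ⟨C, hCI, hdisj, hcov⟩ := exists_disjoint_subfamily I t (fun _ => 0)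
    (fun i _ => (S.ball_nonempty h).map)
  have h1 : I ⊆ C.biUnion fun c => (S.ball (4 * h)).map (mulLeftEmbedding (y c)) := by
    intro x hx
    obtain ⟨c, hc, -, g, hg, hg'⟩ := hcov x hx
    rw [ht, mem_ball] at hg hg'
    refine Finset.mem_biUnion.2 ⟨c, hc, Finset.mem_map.2 ⟨(y c)⁻¹ * x, ?_, by simp⟩⟩
    have e : (y c)⁻¹ * x = ((y c)⁻¹ * g) * ((y x)⁻¹ * g)⁻¹ * ((y x)⁻¹ * x) := by group
    have a1 := S.wordLength_mul_le (((y c)⁻¹ * g) * ((y x)⁻¹ * g)⁻¹) ((y x)⁻¹ * x)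
    have a2 := S.wordLength_mul_le ((y c)⁻¹ * g) ((y x)⁻¹ * g)⁻¹
    have a3 := S.mem_ball.1 (hy x hx)
    rw [wordLength_inv] at a2
    rw [e, mem_ball]
    omega
  have h2 : C.biUnion t ⊆ S.ball (n - h) \ S.ball (n - 4 * h) := by
    intro g hg
    obtain ⟨c, hc, hg⟩ := Finset.mem_biUnion.1 hg
    rw [ht, mem_ball] at hg
    have b1 := hy1 c (hCI hc)
    have b2 := hy2 c (hCI hc)
    have a1 := S.wordLength_mul_le (y c) ((y c)⁻¹ * g)
    have a2 := S.wordLength_mul_le g ((y c)⁻¹ * g)⁻¹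
    rw [wordLength_inv, show g * ((y c)⁻¹ * g)⁻¹ = y c by group] at a2
    rw [mul_inv_cancel_left] at a1
    simp only [Finset.mem_sdiff, mem_ball]
    omega
  calc I.card ≤ ∑ c ∈ C, ((S.ball (4 * h)).map (mulLeftEmbedding (y c))).card :=
        (Finset.card_le_card h1).trans Finset.card_biUnion_le
    _ = C.card * (S.ball (4 * h)).card := by simp
    _ ≤ C.card * (D ^ 2 * (S.ball h).card) := Nat.mul_le_mul_left _ hball4
    _ = D ^ 2 * (C.biUnion t).card := by
      rw [Finset.card_biUnion hdisj]
      simp only [t, Finset.card_map, Finset.sum_const, smul_eq_mul]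
      ring
    _ ≤ _ := Nat.mul_le_mul_left _ (Finset.card_le_card h2)

/-- Spheres are asymptotically negligible in groups with doubling balls. -/
theorem eventually_card_annulus_le {D : ℕ}
    (hD : ∀ n, (S.ball (2 * n)).card ≤ D * (S.ball n).card) {δ : ℝ} (hδ : 0 < δ) (r : ℕ) :
    ∀ᶠ n in atTop, ((S.ball n).card : ℝ) - (S.ball (n - r)).card ≤ δ * (S.ball n).card := by
  -- If an outer shell is at most `D ^ 2` times the next one, it is at most `D ^ 2 / (D ^ 2 + 1)` of
  -- their union. Iterating over the widths `4 ^ j`, `4 ^ (j - 1)`, ... gives geometric decay.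
  have key : ∀ j n : ℕ, 4 ^ j ≤ n → ∀ i, i ≤ j →
      ((D : ℝ) ^ 2 + 1) ^ i * ((S.ball n).card - (S.ball (n - 4 ^ (j - i))).card) ≤
        (D ^ 2 : ℝ) ^ i * ((S.ball n).card - (S.ball (n - 4 ^ j)).card) := by
    intro j n hn i
    induction i with
    | zero => simp
    | succ i ih =>
      intro hi
      have h4 : 4 ^ (j - i) = 4 * 4 ^ (j - (i + 1)) := by
        rw [← pow_succ']; congr 1; omega
      have hle : 4 ^ (j - i) ≤ n := (Nat.pow_le_pow_right (by norm_num) (Nat.sub_le j i)).trans hn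
      have h1 := S.card_annulus_le hD (n := n) (h := 4 ^ (j - (i + 1)))
        (Nat.one_le_pow _ _ (by norm_num)) (by omega)
      rw [← h4] at h1
      have m1 := Finset.card_le_card (S.ball_mono (Nat.sub_le n (4 ^ (j - (i + 1)))))
      have m2 := Finset.card_le_card
        (S.ball_mono (by omega : n - 4 ^ (j - i) ≤ n - 4 ^ (j - (i + 1))))
      have h2 : ((S.ball n).card : ℝ) - (S.ball (n - 4 ^ (j - (i + 1)))).card ≤
          D ^ 2 * ((S.ball (n - 4 ^ (j - (i + 1)))).card - (S.ball (n - 4 ^ (j - i))).card) := by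
        rw [← Nat.cast_sub m1, ← Nat.cast_sub m2]
        exact_mod_cast h1
      have h3 : ((D : ℝ) ^ 2 + 1) * ((S.ball n).card - (S.ball (n - 4 ^ (j - (i + 1)))).card) ≤
          D ^ 2 * ((S.ball n).card - (S.ball (n - 4 ^ (j - i))).card) := by linarith
      calc _ = ((D : ℝ) ^ 2 + 1) ^ i * (((D : ℝ) ^ 2 + 1) *
              ((S.ball n).card - (S.ball (n - 4 ^ (j - (i + 1)))).card)) := by ring
        _ ≤ ((D : ℝ) ^ 2 + 1) ^ i * (D ^ 2 *
              ((S.ball n).card - (S.ball (n - 4 ^ (j - i))).card)) := by gcongr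
        _ = D ^ 2 * (((D : ℝ) ^ 2 + 1) ^ i *
              ((S.ball n).card - (S.ball (n - 4 ^ (j - i))).card)) := by ring
        _ ≤ D ^ 2 * ((D ^ 2 : ℝ) ^ i * ((S.ball n).card - (S.ball (n - 4 ^ j)).card)) :=
          mul_le_mul_of_nonneg_left (ih (by omega)) (by positivity)
        _ = _ := by ring
  set q : ℝ := D ^ 2 / (D ^ 2 + 1) with hq
  have hq0 : 0 ≤ q := by positivity
  have hq1 : q < 1 := by rw [hq, div_lt_one (by positivity)]; linarith
  obtain ⟨i, hi⟩ := exists_pow_lt_of_lt_one hδ hq1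
  filter_upwards [eventually_ge_atTop (4 ^ (r + i))] with n hn
  have h1 := key (r + i) n hn i (by omega)
  rw [Nat.add_sub_cancel] at h1
  have h2 : ((S.ball (n - 4 ^ r)).card : ℝ) ≤ (S.ball (n - r)).card := by
    have : r ≤ 4 ^ r := (Nat.lt_pow_self (by norm_num)).le
    exact_mod_cast Finset.card_le_card (S.ball_mono (by omega))
  have h3 : ((S.ball n).card : ℝ) - (S.ball (n - 4 ^ r)).card ≤ q ^ i * (S.ball n).card := by
    rw [hq, div_pow, div_mul_eq_mul_div, le_div_iff₀ (by positivity), mul_comm]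
    refine h1.trans ?_
    gcongr
    simp
  have h4 : q ^ i * (S.ball n).card ≤ δ * (S.ball n).card := by gcongr
  linarith

theorem isFolnerSeq_ball {D : ℕ} (hD : ∀ n, (S.ball (2 * n)).card ≤ D * (S.ball n).card) :
    IsFolnerSeq S.ball := by
  classical
  refine ⟨S.ball_nonempty, fun K hK δ hδ => ?_⟩
  obtain ⟨r, hr⟩ := S.subset_ball K
  -- Used at radius `n + r`: the bound `1 / 2` compares that ball with the `n`-ball, and `δ / 8`
  -- then makes the shell small.
  have e1 := S.eventually_card_annulus_le hD (δ := min (δ / 8) (1 / 2)) (by positivity) (2 * r)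
  have e2 := (tendsto_add_atTop_nat r).eventually e1
  filter_upwards [e2, eventually_ge_atTop r] with n hn hnr
  have hsub : ((K : Set Γ) * (S.ball n : Set Γ)) ∆ (S.ball n : Set Γ) ⊆
      ((S.ball (n + r) \ S.ball (n - r) : Finset Γ) : Set Γ) := by
    intro g hg
    rw [Finset.coe_sdiff]
    rcases hg with ⟨⟨k, hk, b, hb, rfl⟩, hg⟩ | ⟨hg, hg'⟩
    · refine ⟨?_, fun h => hg (S.ball_mono (Nat.sub_le n r) h)⟩
      have := S.mul_mem_ball (hr hk) hb
      rwa [add_comm] at this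
    · refine ⟨S.ball_mono (Nat.le_add_right n r) hg, fun h => hg' ?_⟩
      obtain ⟨k, hk⟩ := hK
      refine ⟨k, hk, k⁻¹ * g, ?_, by simp⟩
      have hk' : k⁻¹ ∈ S.ball r := by
        rw [mem_ball, wordLength_inv]; exact S.mem_ball.1 (hr hk)
      have := S.mul_mem_ball hk' h
      rwa [Nat.add_sub_cancel' hnr] at this
  have h1 : ((((K : Set Γ) * (S.ball n : Set Γ)) ∆ (S.ball n : Set Γ)).ncard : ℝ) ≤
      (S.ball (n + r)).card - (S.ball (n - r)).card := by
    rw [← Finset.cast_card_sdiff (S.ball_mono (by omega))]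
    exact_mod_cast (Set.ncard_le_ncard hsub (Finset.finite_toSet _)).trans_eq
      (Set.ncard_coe_finset _)
  rw [show n + r - 2 * r = n - r by omega] at hn
  have hpos : (0 : ℝ) < (S.ball n).card := by exact_mod_cast S.card_ball_pos n
  have hmono : ((S.ball (n - r)).card : ℝ) ≤ (S.ball n).card := by
    exact_mod_cast Finset.card_le_card (S.ball_mono (Nat.sub_le n r))
  have hp : (0 : ℝ) ≤ (S.ball (n + r)).card := Nat.cast_nonneg _
  have a1 : min (δ / 8) (1 / 2) * ((S.ball (n + r)).card : ℝ) ≤ 1 / 2 * (S.ball (n + r)).card := by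
    gcongr; exact min_le_right _ _
  have a2 : min (δ / 8) (1 / 2) * ((S.ball (n + r)).card : ℝ) ≤ δ / 8 * (S.ball (n + r)).card := by
    gcongr; exact min_le_left _ _
  have a3 : ((S.ball (n + r)).card : ℝ) ≤ 2 * (S.ball n).card := by linarith
  nlinarith

end SymmGenSet

/-! ### Pattern counts as a subadditive function. -/

theorem restrict_eq_iff {Γ A : Type*} {E : Finset Γ} {x y : Γ → A} :
    E.restrict (π := fun _ => A) x = E.restrict y ↔ ∀ e ∈ E, x e = y e :=
  ⟨fun h e he => congrFun h ⟨e, he⟩, fun h => funext fun e => h e e.2⟩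

namespace Subshift

variable {Γ A : Type*} [Group Γ] [TopologicalSpace A] (𝒳 : Subshift Γ A)

/-- The restrictions to `E` of the configurations of a subshift. -/
def patterns (E : Finset Γ) : Set (E → A) := (E.restrict (π := fun _ => A)) '' 𝒳.carrier

/-- The number of patterns, to the logarithm of base two. -/
noncomputable def logPatterns (E : Finset Γ) : ℝ := Real.logb 2 (𝒳.patterns E).ncard

theorem restrict_mem_patterns {x : Γ → A} (hx : x ∈ 𝒳.carrier) (E : Finset Γ) :
    E.restrict x ∈ 𝒳.patterns E := ⟨x, hx, rfl⟩

/-- Choosing one configuration for each pattern turns an invariant that determines the pattern into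
an injection. All pattern counts below are obtained this way. -/
theorem ncard_patterns_le {β : Type*} {E : Finset Γ} (f : (Γ → A) → β) (s : Set β) (hs : s.Finite)
    (hf : ∀ x ∈ 𝒳.carrier, f x ∈ s)
    (hinj : ∀ x ∈ 𝒳.carrier, ∀ y ∈ 𝒳.carrier, f x = f y → ∀ e ∈ E, x e = y e) :
    (𝒳.patterns E).ncard ≤ s.ncard := by
  rcases 𝒳.carrier.eq_empty_or_nonempty with h0 | ⟨x₀, -⟩
  · simp [patterns, h0]
  have : Nonempty (Γ → A) := ⟨x₀⟩
  have hch : ∀ p ∈ 𝒳.patterns E, ∃ x ∈ 𝒳.carrier, E.restrict x = p := fun p hp => hp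
  choose! g hg hgr using hch
  refine Set.ncard_le_ncard_of_injOn (fun p => f (g p)) (fun p hp => hf _ (hg p hp)) ?_ hs
  intro p hp q hq h
  rw [← hgr p hp, ← hgr q hq]
  funext e
  exact hinj _ (hg p hp) _ (hg q hq) h e e.2

variable [Finite A]

theorem ncard_patterns_pos (h : 𝒳.carrier.Nonempty) (E : Finset Γ) :
    0 < (𝒳.patterns E).ncard :=
  (Set.ncard_pos (Set.toFinite _)).2 (h.image _)

theorem ncard_patterns_translate_le (E : Finset Γ) (c : Γ) :
    (𝒳.patterns (translate E c)).ncard ≤ (𝒳.patterns E).ncard := by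
  refine 𝒳.ncard_patterns_le (fun x => E.restrict (shift c x)) _ (Set.toFinite _)
    (fun x hx => 𝒳.restrict_mem_patterns (𝒳.shift_mem c x hx) E) fun x _ y _ h e he => ?_
  have := restrict_eq_iff.1 h _ (mem_translate.1 he)
  simpa [shift] using this

theorem isSubadd_logPatterns (h : 𝒳.carrier.Nonempty) : IsSubadd 𝒳.logPatterns where
  nonneg E := Real.logb_nonneg (by norm_num) (by exact_mod_cast 𝒳.ncard_patterns_pos h E)
  empty := by
    have h1 : (𝒳.patterns ∅).ncard ≤ 1 := by
      have := Set.ncard_le_card (𝒳.patterns ∅)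
      simpa using this
    have h2 := 𝒳.ncard_patterns_pos h ∅
    simp [logPatterns, show (𝒳.patterns ∅).ncard = 1 by omega]
  le_add E E' C hC := by
    have h1 : (𝒳.patterns C).ncard ≤ (𝒳.patterns E).ncard * (𝒳.patterns E').ncard := by
      rw [← Set.ncard_prod]
      refine 𝒳.ncard_patterns_le (fun x => (E.restrict x, E'.restrict x)) _ (Set.toFinite _)
        (fun x hx => ⟨𝒳.restrict_mem_patterns hx E, 𝒳.restrict_mem_patterns hx E'⟩)
        fun x _ y _ h e he => ?_
      rcases hC e he with he | he
      · exact restrict_eq_iff.1 (Prod.ext_iff.1 h).1 e he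
      · exact restrict_eq_iff.1 (Prod.ext_iff.1 h).2 e he
    have p := 𝒳.ncard_patterns_pos h
    have p1 : (0 : ℝ) < (𝒳.patterns C).ncard := by exact_mod_cast p C
    have p2 : ((𝒳.patterns E).ncard : ℝ) ≠ 0 := by exact_mod_cast (p E).ne'
    have p3 : ((𝒳.patterns E').ncard : ℝ) ≠ 0 := by exact_mod_cast (p E').ne'
    unfold logPatterns
    rw [← Real.logb_mul p2 p3]
    exact Real.logb_le_logb_of_le (by norm_num) p1 (by exact_mod_cast h1)
  translate E c := by
    have h1 := 𝒳.ncard_patterns_translate_le E c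
    have h2 := 𝒳.ncard_patterns_translate_le (translate E c) c⁻¹
    have e : translate (translate E c) c⁻¹ = E := by ext; simp [mem_translate]
    rw [e] at h2
    rw [logPatterns, logPatterns, le_antisymm h1 h2]

theorem two_rpow_logPatterns (h : 𝒳.carrier.Nonempty) (E : Finset Γ) :
    (2 : ℝ) ^ 𝒳.logPatterns E = (𝒳.patterns E).ncard :=
  Real.rpow_logb (by norm_num) (by norm_num) (by exact_mod_cast 𝒳.ncard_patterns_pos h E)

end Subshift

theorem ofReal_div_card {a : ℝ} {n : ℕ} (hn : 0 < n) :
    ENNReal.ofReal a / (n : ℝ≥0∞) = ENNReal.ofReal (a / n) := by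
  rw [ENNReal.ofReal_div_of_pos (by exact_mod_cast hn), ENNReal.ofReal_natCast]

theorem Subshift.tendsto_patternRate {Γ A : Type*} [Group Γ] [TopologicalSpace A]
    (𝒳 : Subshift Γ A) {h : ℝ}
    (hu : IsUpperRate 𝒳.logPatterns h) (hl : IsLowerRate 𝒳.logPatterns h)
    {E : ℕ → Finset Γ} (hE : IsFolnerSeq E) :
    Tendsto (𝒳.patternRate E) atTop (𝓝 (ENNReal.ofReal h)) := by
  refine (ENNReal.tendsto_ofReal (hu.tendsto hl hE)).congr fun n => ?_
  rw [← ofReal_div_card (hE.1 n).card_pos]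
  rfl

theorem exists_scale {ε : ℝ} (hε : 0 < ε) :
    ∃ k : ℕ, (2⁻¹ : ℝ) ^ k < ε ∧ ∀ j < k, ε ≤ (2⁻¹ : ℝ) ^ j := by
  have h : ∃ k : ℕ, (2⁻¹ : ℝ) ^ k < ε := exists_pow_lt_of_lt_one hε (by norm_num)
  exact ⟨Nat.find h, Nat.find_spec h, fun j hj => not_lt.1 (Nat.find_min h hj)⟩

/-- The elements of word length less than `k`. -/
noncomputable def SymmGenSet.openBall {Γ : Type*} [Group Γ] (S : SymmGenSet Γ) (k : ℕ) :
    Finset Γ := (S.ball k).filter fun g => S.wordLength g < k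

theorem SymmGenSet.mem_openBall {Γ : Type*} [Group Γ] {S : SymmGenSet Γ} {k : ℕ} {g : Γ} :
    g ∈ S.openBall k ↔ S.wordLength g < k := by
  simp only [openBall, Finset.mem_filter, S.mem_ball]; omega

/-! ### Dynamical metrics, windows and covering numbers. -/

section Window

variable {G₁ G₂ A : Type*} [Group G₁] [Group G₂] (S₁ : SymmGenSet G₁) (S₂ : SymmGenSet G₂)

open Classical in
/-- The `k`-neighbourhood of `F` in the first coordinate, times the open `k`-ball. -/
noncomputable def window (k : ℕ) (F : Finset G₁) : Finset (G₁ × G₂) :=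
  Finset.image₂ (· * ·) (S₁.openBall k) F ×ˢ S₂.openBall k

variable {S₁ S₂}

theorem mem_window {k : ℕ} {F : Finset G₁} {p : G₁ × G₂} : p ∈ window S₁ S₂ k F ↔
    (∃ a, S₁.wordLength a < k ∧ ∃ g ∈ F, a * g = p.1) ∧ S₂.wordLength p.2 < k := by
  classical
  simp only [window, Finset.mem_product, Finset.mem_image₂, SymmGenSet.mem_openBall]

/-- Length below `k + 1` means length at most `k`, and cutting geodesics shows that the product of
two balls is the full ball of the summed radius. -/
theorem window_ball (k N : ℕ) :
    window S₁ S₂ (k + 1) (S₁.ball N) = S₁.ball (k + N) ×ˢ S₂.ball k := by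
  ext p
  simp only [mem_window, Nat.lt_succ_iff, Finset.mem_product, ← SymmGenSet.mem_ball]
  refine and_congr_left fun _ => ⟨?_, fun h => S₁.exists_mul_eq_of_mem_ball_add h⟩
  rintro ⟨a, ha, g, hg, e⟩
  rw [← e]
  exact S₁.mul_mem_ball ha hg

/-- Windows commute with unions and with right translation by `(c, 1)`; this permits Ornstein–Weiss
in `G₁` alone, at each fixed scale. -/
theorem isSubadd_window {φ : Finset (G₁ × G₂) → ℝ} (hφ : IsSubadd φ) (k : ℕ) :
    IsSubadd fun F : Finset G₁ => φ (window S₁ S₂ k F) where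
  nonneg F := hφ.nonneg _
  empty := by
    have : window S₁ S₂ k (∅ : Finset G₁) = ∅ := by ext; simp [mem_window]
    rw [this, hφ.empty]
  le_add F F' C hC := hφ.le_add _ _ _ fun p hp => by
    obtain ⟨⟨a, ha, g, hg, e⟩, hb⟩ := mem_window.1 hp
    exact (hC g hg).imp (fun h => mem_window.2 ⟨⟨a, ha, g, h, e⟩, hb⟩)
      fun h => mem_window.2 ⟨⟨a, ha, g, h, e⟩, hb⟩
  translate F c := by
    rw [← hφ.translate (window S₁ S₂ k F) (c, 1)]
    congr 1
    ext p
    simp only [mem_window, mem_translate, Prod.inv_mk, inv_one, Prod.fst_mul, Prod.snd_mul, mul_one]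
    refine and_congr_left fun _ => ⟨?_, ?_⟩
    · rintro ⟨a, ha, g, hg, e⟩
      exact ⟨a, ha, _, hg, by rw [← e, mul_assoc]⟩
    · rintro ⟨a, ha, g, hg, e⟩
      exact ⟨a, ha, g * c, by simpa using hg, by rw [← mul_assoc, e, inv_mul_cancel_right]⟩

theorem two_inv_lt_one : (2⁻¹ : ℝ≥0) < 1 := by
  rw [← NNReal.coe_lt_coe]; norm_num

theorem configDist_le_iff {x y : G₁ × G₂ → A} {k : ℕ} :
    configDist S₁ S₂ x y ≤ 2⁻¹ ^ k ↔ ∀ p, supLength S₁ S₂ p < k → x p = y p := by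
  unfold configDist
  split_ifs with h
  · subst h; simp
  · have hne : (supLength S₁ S₂ '' {g | x g ≠ y g}).Nonempty := by
      obtain ⟨g, hg⟩ := Function.ne_iff.1 h
      exact ⟨_, g, hg, rfl⟩
    rw [pow_le_pow_iff_right_of_lt_one₀ (by positivity) two_inv_lt_one]
    constructor
    · intro hk p hp
      by_contra hne'
      have := Nat.sInf_le (s := supLength S₁ S₂ '' {g | x g ≠ y g}) ⟨p, hne', rfl⟩
      omega
    · intro hk
      obtain ⟨p, hp, e⟩ := Nat.sInf_mem hne
      rw [← e]
      by_contra! hlt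
      exact hp (hk p hlt)

/-- There are no distances strictly between consecutive powers of 1/2. -/
theorem configDist_lt_pow {x y : G₁ × G₂ → A} {k : ℕ} (h : configDist S₁ S₂ x y < 2⁻¹ ^ k) :
    configDist S₁ S₂ x y ≤ 2⁻¹ ^ (k + 1) := by
  unfold configDist at *
  split_ifs at * with h'
  · simp
  · rw [pow_lt_pow_iff_right_of_lt_one₀ (by positivity) two_inv_lt_one] at h
    exact pow_le_pow_of_le_one (by positivity) two_inv_lt_one.le h

variable [TopologicalSpace A] {𝒳 : Subshift (G₁ × G₂) A}

theorem dynDist_le_iff {F : Finset G₁} {x y : 𝒳.carrier} {k : ℕ} :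
    dynDist 𝒳.sigmaOne (𝒳.dist S₁ S₂) F x y ≤ 2⁻¹ ^ k ↔
      ∀ p ∈ window S₁ S₂ k F, x.1 p = y.1 p := by
  unfold dynDist
  rw [Finset.sup_le_iff]
  simp only [Subshift.dist, configDist_le_iff, supLength, max_lt_iff, Subshift.sigmaOne]
  constructor
  · intro h p hp
    obtain ⟨⟨a, ha, g, hg, e⟩, hb⟩ := mem_window.1 hp
    have := h g hg (a, p.2) ⟨ha, hb⟩
    simpa [e] using this
  · intro h g hg p hp
    exact h (p.1 * g, p.2) (mem_window.2 ⟨⟨_, hp.1, g, hg, rfl⟩, hp.2⟩)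

theorem dynDist_lt_pow {F : Finset G₁} {x y : 𝒳.carrier} {k : ℕ}
    (h : dynDist 𝒳.sigmaOne (𝒳.dist S₁ S₂) F x y < 2⁻¹ ^ k) :
    dynDist 𝒳.sigmaOne (𝒳.dist S₁ S₂) F x y ≤ 2⁻¹ ^ (k + 1) := by
  unfold dynDist at *
  rw [Finset.sup_lt_iff (by simp)] at h
  exact Finset.sup_le fun g hg => configDist_lt_pow (h g hg)

theorem dynDist_le_one {F : Finset G₁} {x y : 𝒳.carrier} :
    dynDist 𝒳.sigmaOne (𝒳.dist S₁ S₂) F x y ≤ 1 := by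
  have := (dynDist_le_iff (S₁ := S₁) (S₂ := S₂) (𝒳 := 𝒳) (F := F) (x := x) (y := y) (k := 0)).2
    (fun p hp => by simp [mem_window] at hp)
  simpa using this

theorem dist_le_diam {X : Type*} {d : X → X → ℝ≥0} {E : Set X} {x y : X} (hx : x ∈ E)
    (hy : y ∈ E) : (d x y : ℝ≥0∞) ≤ diam d E :=
  le_iSup₂_of_le x hx (le_iSup₂_of_le y hy le_rfl)

theorem diam_le {X : Type*} {d : X → X → ℝ≥0} {E : Set X} {r : ℝ≥0∞}
    (h : ∀ x ∈ E, ∀ y ∈ E, (d x y : ℝ≥0∞) ≤ r) : diam d E ≤ r :=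
  iSup₂_le fun x hx => iSup₂_le fun y hy => h x hx y hy

theorem eqOn_window_of_dynDist_lt {F : Finset G₁} {x y : 𝒳.carrier} {k : ℕ} {ε : ℝ}
    (hk : ∀ j < k, ε ≤ (2⁻¹ : ℝ) ^ j)
    (h : (dynDist 𝒳.sigmaOne (𝒳.dist S₁ S₂) F x y : ℝ) < ε) :
    ∀ p ∈ window S₁ S₂ k F, x.1 p = y.1 p := by
  rw [← dynDist_le_iff]
  cases k with
  | zero => simpa using dynDist_le_one
  | succ k =>
    refine dynDist_lt_pow ?_
    have := h.trans_le (hk k (Nat.lt_succ_self k))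
    rw [← NNReal.coe_lt_coe]
    push_cast
    exact this

/-- Cylinders over the window are open and small enough. Conversely, points in a common set of
diameter below `ε` agree on the window, so any admissible cover has at least as many members as
there are patterns. -/
theorem openCoveringNumber_eq [Finite A] [DiscreteTopology A] {F : Finset G₁} {k : ℕ} {ε : ℝ}
    (hk : (2⁻¹ : ℝ) ^ k < ε) (hk' : ∀ j < k, ε ≤ (2⁻¹ : ℝ) ^ j) :
    openCoveringNumber (dynDist 𝒳.sigmaOne (𝒳.dist S₁ S₂) F) ε =
      (𝒳.patterns (window S₁ S₂ k F)).ncard := by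
  have hε : 0 < ε := lt_trans (by positivity) hk
  set W := window S₁ S₂ k F with hW
  have hmem : (𝒳.patterns W).ncard ∈ {n : ℕ | ∃ U : Fin n → Set 𝒳.carrier, (∀ i, IsOpen (U i)) ∧
      (∀ i, diam (dynDist 𝒳.sigmaOne (𝒳.dist S₁ S₂) F) (U i) < ENNReal.ofReal ε) ∧
      ⋃ i, U i = univ} := by
    rw [← Nat.card_coe_set_eq]
    let e := Finite.equivFin (𝒳.patterns W)
    refine ⟨fun i => {x | W.restrict x.1 = (e.symm i).1}, fun i => ?_, fun i => ?_, ?_⟩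
    · have hc : Continuous fun x : 𝒳.carrier => W.restrict (π := fun _ => A) x.1 :=
        continuous_pi fun p => (continuous_apply p.1).comp continuous_subtype_val
      exact (isOpen_discrete {(e.symm i).1}).preimage hc
    · refine (diam_le (r := ((2⁻¹ ^ k : ℝ≥0) : ℝ≥0∞)) fun x hx y hy => ?_).trans_lt ?_
      · rw [ENNReal.coe_le_coe, dynDist_le_iff]
        exact restrict_eq_iff.1 (hx.trans hy.symm)
      · rw [← ENNReal.ofReal_coe_nnreal]
        push_cast
        exact (ENNReal.ofReal_lt_ofReal_iff hε).2 hk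
    · refine Set.eq_univ_of_forall fun x => Set.mem_iUnion.2
        ⟨e ⟨_, 𝒳.restrict_mem_patterns x.2 W⟩, ?_⟩
      rw [Set.mem_ofPred_eq, Equiv.symm_apply_apply]
  refine le_antisymm (Nat.sInf_le hmem) (le_csInf ⟨_, hmem⟩ ?_)
  rintro n ⟨U, -, hU, hcov⟩
  have hch : ∀ x ∈ 𝒳.carrier, ∃ i, ∀ h : x ∈ 𝒳.carrier, (⟨x, h⟩ : 𝒳.carrier) ∈ U i := by
    intro x hx
    obtain ⟨i, hi⟩ := Set.mem_iUnion.1 (hcov.symm ▸ Set.mem_univ (⟨x, hx⟩ : 𝒳.carrier))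
    exact ⟨i, fun _ => hi⟩
  rcases Set.eq_empty_or_nonempty 𝒳.carrier with h0 | ⟨x₀, hx₀⟩
  · simp [Subshift.patterns, h0]
  have : Nonempty (Fin n) := ⟨(hch x₀ hx₀).choose⟩
  choose! f hf using hch
  refine (𝒳.ncard_patterns_le f Set.univ Set.finite_univ (fun _ _ => Set.mem_univ _)
    fun x hx y hy hxy => ?_).trans (by simp)
  refine eqOn_window_of_dynDist_lt (x := ⟨x, hx⟩) (y := ⟨y, hy⟩) hk' ?_
  have h1 := (dist_le_diam (hf x hx hx) (hxy ▸ hf y hy hy)).trans_lt (hU (f x))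
  rw [← ENNReal.ofReal_coe_nnreal, ENNReal.ofReal_lt_ofReal_iff hε] at h1
  exact h1

theorem tendsto_coverRate [Finite A] [DiscreteTopology A] {k : ℕ} {ε s : ℝ}
    (hk : (2⁻¹ : ℝ) ^ k < ε) (hk' : ∀ j < k, ε ≤ (2⁻¹ : ℝ) ^ j)
    (hu : IsUpperRate (fun F => 𝒳.logPatterns (window S₁ S₂ k F)) s)
    (hl : IsLowerRate (fun F => 𝒳.logPatterns (window S₁ S₂ k F)) s)
    {F : ℕ → Finset G₁} (hF : IsFolnerSeq F) :
    Tendsto (coverRate 𝒳.sigmaOne (𝒳.dist S₁ S₂) F ε) atTop (𝓝 (ENNReal.ofReal s)) := by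
  refine (ENNReal.tendsto_ofReal (hu.tendsto hl hF)).congr fun n => ?_
  rw [← ofReal_div_card (hF.1 n).card_pos, coverRate, openCoveringNumber_eq hk hk']
  rfl

end Window

/-! ### Invariance of product sets. -/

theorem exists_subset_product {G₁ G₂ : Type*} (K : Finset (G₁ × G₂)) :
    ∃ (K₁ : Finset G₁) (K₂ : Finset G₂), K ⊆ K₁ ×ˢ K₂ := by
  classical
  exact ⟨K.image Prod.fst, K.image Prod.snd, Finset.subset_product⟩

section Product

variable {G₁ G₂ : Type*} [Group G₁] [Group G₂]

theorem IsInvariant.prod {K : Finset (G₁ × G₂)} {K₁ A : Finset G₁} {K₂ B : Finset G₂}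
    (hK : K ⊆ K₁ ×ˢ K₂) {δ₁ δ₂ : ℝ} (hA : IsInvariant K₁ δ₁ A) (hB : IsInvariant K₂ δ₂ B) :
    IsInvariant K (δ₁ + δ₂) (A ×ˢ B) := by
  classical
  have hsub : innerBdry K (A ×ˢ B) ⊆ innerBdry K₁ A ×ˢ B ∪ A ×ˢ innerBdry K₂ B := by
    rintro ⟨a, b⟩ h
    obtain ⟨hab, k, hk, hkab⟩ := mem_innerBdry.1 h
    have hk' := Finset.mem_product.1 (hK hk)
    rw [Finset.mem_product] at hab hkab
    simp only [Finset.mem_union, Finset.mem_product, mem_innerBdry]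
    by_cases ha : k.1 * a ∈ A
    · exact Or.inr ⟨hab.1, hab.2, k.2, hk'.2, fun hb => hkab ⟨ha, hb⟩⟩
    · exact Or.inl ⟨⟨hab.1, k.1, hk'.1, ha⟩, hab.2⟩
  have h1 : ((innerBdry K (A ×ˢ B)).card : ℝ) ≤
      (innerBdry K₁ A).card * B.card + A.card * (innerBdry K₂ B).card := by
    have := (Finset.card_le_card hsub).trans (Finset.card_union_le _ _)
    rw [Finset.card_product, Finset.card_product] at this
    exact_mod_cast this
  unfold IsInvariant at *
  rw [Finset.card_product]
  push_cast
  have h2 : ((innerBdry K₁ A).card : ℝ) * B.card ≤ δ₁ * A.card * B.card := by gcongr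
  have h3 : (A.card : ℝ) * (innerBdry K₂ B).card ≤ A.card * (δ₂ * B.card) := by gcongr
  linarith

end Product

/-! ### The upper bound for metric mean dimension. -/

section UpperBound

variable {G₁ G₂ A : Type*} [Group G₁] [Group G₂] {S₁ : SymmGenSet G₁} {S₂ : SymmGenSet G₂}

/-- With `k` fixed first, the window exceeds `F n × B_k` only over the product of `B_k` with the
boundary of `F n`, which becomes negligible in `n`. The box `F n × B_k` is invariant in `G` once
both factors are. -/
theorem window_rate_le {φ : Finset (G₁ × G₂) → ℝ} (hφ : IsSubadd φ) {h : ℝ} (hu : IsUpperRate φ h)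
    {F : ℕ → Finset G₁} (hF : IsFolnerSeq F) (hB : IsFolnerSeq S₂.ball) {s : ℕ → ℝ}
    (hs : ∀ k, Tendsto (fun n => φ (window S₁ S₂ k (F n)) / (F n).card) atTop (𝓝 (s k)))
    {η : ℝ} (hη : 0 < η) :
    ∀ᶠ k in atTop, s (k + 1) ≤ (h + η) * (S₂.ball k).card := by
  classical
  obtain ⟨K, δ, hδ, hinv⟩ := hu (η / 2) (half_pos hη)
  obtain ⟨K₁, K₂, hK⟩ := exists_subset_product K
  filter_upwards [hB.eventually_isInvariant K₂ (half_pos hδ)] with k hk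
  have hM : 0 ≤ φ {1} := hφ.nonneg _
  have hbpos : (0 : ℝ) < (S₁.ball k).card := by exact_mod_cast S₁.card_ball_pos k
  refine le_of_tendsto (hs (k + 1)) ?_
  -- The second tolerance offsets both the size of `B_k` and the trivial rate `φ {1}` on the excess.
  filter_upwards [hF.eventually_isInvariant K₁ (half_pos hδ),
    hF.eventually_isInvariant (S₁.ball k)
      (δ := η / 2 / ((φ {1} + 1) * (S₁.ball k).card)) (by positivity)] with n hn1 hn2
  have hpos : (0 : ℝ) < (F n).card := by exact_mod_cast (hF.1 n).card_pos
  rw [div_le_iff₀ hpos]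
  set N := Finset.image₂ (· * ·) (S₁.ball k) (innerBdry (S₁.ball k) (F n)) with hN
  have h1 : φ (window S₁ S₂ (k + 1) (F n)) ≤
      φ (F n ×ˢ S₂.ball k) + φ (N ×ˢ S₂.ball k) := by
    refine hφ.le_add _ _ _ fun p hp => ?_
    obtain ⟨⟨a, ha, g, hg, e⟩, hb⟩ := mem_window.1 hp
    rw [Nat.lt_succ_iff, ← SymmGenSet.mem_ball] at ha hb
    simp only [Finset.mem_product]
    by_cases hp1 : p.1 ∈ F n
    · exact Or.inl ⟨hp1, hb⟩
    · exact Or.inr ⟨Finset.mem_image₂.2 ⟨a, ha, g, mem_innerBdry.2 ⟨hg, a, ha, by rwa [e]⟩, e⟩, hb⟩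
  have h2 := hinv _ ((hn1.prod hK hk).mono subset_rfl (add_halves δ).le)
  have hNc : (φ {1} + 1) * (N.card : ℝ) ≤ η / 2 * (F n).card := by
    have : (N.card : ℝ) ≤ (S₁.ball k).card * (innerBdry (S₁.ball k) (F n)).card := by
      exact_mod_cast Finset.card_image₂_le _ _ _
    calc (φ {1} + 1) * (N.card : ℝ) ≤ (φ {1} + 1) * ((S₁.ball k).card *
          (η / 2 / ((φ {1} + 1) * (S₁.ball k).card) * (F n).card)) := by
          gcongr
          exact this.trans (mul_le_mul_of_nonneg_left hn2 (by positivity))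
      _ = _ := by field_simp
  have h3 : φ (N ×ˢ S₂.ball k) ≤ η / 2 * (F n).card * (S₂.ball k).card := by
    refine (hφ.le_card_mul _).trans ?_
    rw [Finset.card_product]
    push_cast
    rw [← mul_assoc]
    refine mul_le_mul_of_nonneg_right (le_trans ?_ hNc) (Nat.cast_nonneg _)
    gcongr
    linarith
  rw [Finset.card_product] at h2
  push_cast at h2
  calc _ ≤ _ := h1
    _ ≤ (h + η / 2) * ((F n).card * (S₂.ball k).card) + η / 2 * (F n).card * (S₂.ball k).card :=
      add_le_add h2 h3
    _ = _ := by ring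

/-- Converts statements for large `k` into statements for small `ε`, where `2⁻¹ ^ (k + 1) < ε ≤ 2⁻¹
^ k`. -/
theorem eventually_scale {p : ℕ → Prop} (hp : ∀ᶠ k in atTop, p k) :
    ∀ᶠ ε : ℝ in 𝓝[>] 0, ∃ k : ℕ, 1 ≤ k ∧ p k ∧ 0 < ε ∧ (2⁻¹ : ℝ) ^ (k + 1) < ε ∧
      (∀ j < k + 1, ε ≤ (2⁻¹ : ℝ) ^ j) ∧ (k : ℝ) ≤ |Real.logb 2 ε| := by
  obtain ⟨m, hm⟩ := eventually_atTop.1 (hp.and (eventually_ge_atTop 1))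
  filter_upwards [Ioc_mem_nhdsGT (show (0 : ℝ) < 2⁻¹ ^ m by positivity)] with ε hε
  obtain ⟨k, hk, hk'⟩ := exists_scale hε.1
  have hmk : m < k := by
    have := hk.trans_le hε.2
    rwa [pow_lt_pow_iff_right_of_lt_one₀ (by norm_num) (by norm_num)] at this
  obtain ⟨k, rfl⟩ : ∃ k', k = k' + 1 := ⟨k - 1, by omega⟩
  obtain ⟨h1, h2⟩ := hm k (by omega)
  refine ⟨k, h2, h1, hε.1, hk, hk', ?_⟩
  have h3 : Real.logb 2 ε ≤ -k := by
    rw [Real.logb_le_iff_le_rpow (by norm_num) hε.1, Real.rpow_neg (by norm_num),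
      Real.rpow_natCast, ← inv_pow]
    exact hk' k (by omega)
  exact (by linarith : (k : ℝ) ≤ -Real.logb 2 ε).trans (neg_le_abs _)

/-- Linear growth of `G₂` enters here. Finiteness keeps the product with the entropy continuous when
the error `η` tends to zero. -/
theorem upperLinearRate_ne_top (hG₂ : HasPolynomialGrowth G₂ 1) (S₂ : SymmGenSet G₂) :
    upperLinearRate S₂ ≠ ∞ := by
  obtain ⟨a, b, ha, hb, hab⟩ := hG₂.bounds S₂
  refine ne_top_of_le_ne_top (ENNReal.ofReal_ne_top (r := b)) (limsup_le_of_le (h := ?_))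
  filter_upwards [eventually_ge_atTop 1] with n hn
  have hn0 : (0 : ℝ) < n := by exact_mod_cast hn
  rw [← ENNReal.ofReal_natCast (S₂.ball n).card, ofReal_div_card hn]
  refine ENNReal.ofReal_le_ofReal ?_
  rw [div_le_iff₀ hn0]
  simpa using (hab n hn).2

variable [TopologicalSpace A] {𝒳 : Subshift (G₁ × G₂) A}

theorem upperMetricMeanDim_le [Finite A] [DiscreteTopology A] {F : ℕ → Finset G₁} {s : ℕ → ℝ}
    {h : ℝ}
    (hc : upperLinearRate S₂ ≠ ∞)
    (hlim : ∀ k ε, (2⁻¹ : ℝ) ^ k < ε → (∀ j < k, ε ≤ (2⁻¹ : ℝ) ^ j) →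
      coverEntropy 𝒳.sigmaOne (𝒳.dist S₁ S₂) F ε = ENNReal.ofReal (s k))
    (hs : ∀ η : ℝ, 0 < η → ∀ᶠ k in atTop, s (k + 1) ≤ (h + η) * (S₂.ball k).card) :
    upperMetricMeanDim 𝒳.sigmaOne (𝒳.dist S₁ S₂) F ≤
      upperLinearRate S₂ * ENNReal.ofReal h := by
  have key : ∀ η : ℝ, 0 < η → upperMetricMeanDim 𝒳.sigmaOne (𝒳.dist S₁ S₂) F ≤
      (upperLinearRate S₂ + ENNReal.ofReal η) * (ENNReal.ofReal (h + η)) := by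
    intro η hη
    have h1 : ∀ᶠ n : ℕ in atTop, ((S₂.ball n).card : ℝ≥0∞) / (n : ℝ≥0∞) <
        upperLinearRate S₂ + ENNReal.ofReal η := by
      refine eventually_lt_of_limsup_lt ?_
      exact ENNReal.lt_add_right hc (by simpa using hη)
    refine limsup_le_of_le (h := ?_)
    filter_upwards [eventually_scale (h1.and (hs η hη))] with ε hε
    obtain ⟨k, hk1, ⟨hk2, hk3⟩, hε0, hk, hk', hlog⟩ := hε
    have hk0 : (0 : ℝ) < k := by exact_mod_cast hk1
    rw [hlim _ _ hk hk']
    calc ENNReal.ofReal (s (k + 1)) / ENNReal.ofReal |Real.logb 2 ε|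
        ≤ ENNReal.ofReal ((S₂.ball k).card * (h + η)) / ENNReal.ofReal k := by
          refine ENNReal.div_le_div (ENNReal.ofReal_le_ofReal ?_) (ENNReal.ofReal_le_ofReal hlog)
          rwa [mul_comm]
      _ = ((S₂.ball k).card : ℝ≥0∞) / (k : ℝ≥0∞) * ENNReal.ofReal (h + η) := by
        rw [ENNReal.ofReal_mul (by positivity), ENNReal.ofReal_natCast, ENNReal.ofReal_natCast,
          ENNReal.mul_div_right_comm]
      _ ≤ _ := by gcongr
  have ht : Tendsto (fun η : ℝ => (upperLinearRate S₂ + ENNReal.ofReal η) * ENNReal.ofReal (h + η))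
      (𝓝[>] 0) (𝓝 ((upperLinearRate S₂ + ENNReal.ofReal 0) * ENNReal.ofReal (h + 0))) := by
    refine Tendsto.mono_left ?_ nhdsWithin_le_nhds
    refine ENNReal.Tendsto.mul ?_ (Or.inr ENNReal.ofReal_ne_top) ?_ (Or.inr ?_)
    · exact tendsto_const_nhds.add (ENNReal.tendsto_ofReal tendsto_id)
    · exact ENNReal.tendsto_ofReal (tendsto_const_nhds.add tendsto_id)
    · simpa using hc
  rw [ENNReal.ofReal_zero, add_zero, add_zero] at ht
  exact ge_of_tendsto ht (eventually_mem_nhdsWithin.mono fun η hη => key η hη)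

end UpperBound

/-! ### Counting patterns through tilings by cylinders. -/

section Tiling

variable {Γ : Type*} [Group Γ]

/-- Vitali covering by translates of an increasing family of sets with doubling. -/
theorem exists_disjoint_translates {Q W : ℕ → Finset Γ} (hQ : Monotone Q)
    (hne : ∀ k, (Q k).Nonempty) (hW : ∀ k, ∀ a ∈ Q k, ∀ b ∈ Q k, a⁻¹ * b ∈ W k) {D : ℕ}
    (hD : ∀ k, (W k).card ≤ D * (Q k).card) (I : Finset Γ) (κ : Γ → ℕ) :
    ∃ C ⊆ I, (C : Set Γ).PairwiseDisjoint (fun c => translate (Q (κ c)) c) ∧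
      I.card ≤ D * ∑ c ∈ C, (Q (κ c)).card := by
  classical
  obtain ⟨C, hCI, hdisj, hcov⟩ := exists_disjoint_subfamily I (fun c => translate (Q (κ c)) c) κ
    (fun c _ => (hne _).map)
  refine ⟨C, hCI, hdisj, ?_⟩
  have hsub : I ⊆ C.biUnion fun c => translate (W (κ c)) c := by
    intro i hi
    obtain ⟨c, hc, hle, x, hxi, hxc⟩ := hcov i hi
    rw [mem_translate] at hxi hxc
    refine Finset.mem_biUnion.2 ⟨c, hc, mem_translate.2 ?_⟩
    -- As the rank of `c` is no smaller, both `x * i⁻¹` and `x * c⁻¹` lie in the larger tile, and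
    -- their quotient is `i * c⁻¹`.
    have := hW _ _ (hQ hle hxi) _ hxc
    simpa [mul_assoc] using this
  calc I.card ≤ ∑ c ∈ C, (translate (W (κ c)) c).card :=
        (Finset.card_le_card hsub).trans Finset.card_biUnion_le
    _ ≤ ∑ c ∈ C, D * (Q (κ c)).card := Finset.sum_le_sum fun c _ => by simpa using hD (κ c)
    _ = _ := (Finset.mul_sum _ _ _).symm

variable {A : Type*} [TopologicalSpace A] [Finite A] {𝒳 : Subshift Γ A}

/-- Counting patterns through tilings: if every configuration in the subshift admits an encoding
`f y` of a tiling of part of `Ω`, which determines `y` off the remainder `R (f y)`, then the number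
of patterns on `Ω` is bounded by the sum over all encodings of the number of patterns on the
remainder. -/
theorem ncard_patterns_le_sum {β : Type*} (Ω : Finset Γ) (V : Finset β) (f : (Γ → A) → β)
    (hf : ∀ y ∈ 𝒳.carrier, f y ∈ V) (R : β → Finset Γ)
    (hR : ∀ y ∈ 𝒳.carrier, ∀ z ∈ 𝒳.carrier, f y = f z → ∀ p ∈ Ω, p ∉ R (f y) → y p = z p) :
    (𝒳.patterns Ω).ncard ≤ ∑ b ∈ V, (𝒳.patterns (R b)).ncard := by
  classical
  have hcard : ∑ b ∈ V, (𝒳.patterns (R b)).ncard =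
      (V.sigma fun b => (Set.toFinite (𝒳.patterns (R b))).toFinset).card := by
    rw [Finset.card_sigma]
    exact Finset.sum_congr rfl fun b _ => Set.ncard_eq_toFinset_card _ _
  rw [hcard, ← Set.ncard_coe_finset]
  refine 𝒳.ncard_patterns_le (fun y => (⟨f y, (R (f y)).restrict y⟩ : Σ b, (R b → A))) _
    (Finset.finite_toSet _) (fun y hy => ?_) fun y hy z hz h p hp => ?_
  · simpa using ⟨hf y hy, 𝒳.restrict_mem_patterns hy _⟩
  · obtain ⟨h1, h2⟩ := Sigma.mk.inj_iff.1 h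
    by_cases hpR : p ∈ R (f y)
    · have aux : ∀ b b' : β, b = b' → HEq ((R b).restrict (π := fun _ => A) y)
          ((R b').restrict (π := fun _ => A) z) → ∀ p ∈ R b, y p = z p := by
        rintro b _ rfl h
        exact restrict_eq_iff.1 (eq_of_heq h)
      exact aux _ _ h1 h2 p hpR
    · exact hR y hy z hz h1 p hp hpR

/-- A cover of a subshift of entropy `h` by cylinders over tiles `Q`, each of weight at least
`2 ^ (- (h - θ) |Q|)`, has total weight at least one. -/
theorem one_le_sum_of_cylinder_cover (h𝒳 : 𝒳.carrier.Nonempty) {h : ℝ} (hh : 0 ≤ h)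
    (hu : IsUpperRate 𝒳.logPatterns h) (hl : IsLowerRate 𝒳.logPatterns h)
    (hΓ : ∀ (K : Finset Γ) (δ : ℝ), 0 < δ → ∃ T : Finset Γ, T.Nonempty ∧ IsInvariant K δ T)
    {θ : ℝ} (hθ : 0 < θ) {D : ℕ} (hD0 : 1 ≤ D) :
    ∃ (K : Finset Γ) (δ q : ℝ), 0 < δ ∧ ∀ (Q W : ℕ → Finset Γ), Monotone Q →
      (∀ k, (Q k).Nonempty) → (∀ k, ∀ a ∈ Q k, ∀ b ∈ Q k, a⁻¹ * b ∈ W k) →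
      (∀ k, (W k).card ≤ D * (Q k).card) →
      ∀ {ι : Type} (J : Finset ι) (k : ι → ℕ) (x : ι → Γ → A) (w : ι → ℝ),
      (∀ j ∈ J, ((outerBdry K (Q (k j))).card : ℝ) ≤ δ * (Q (k j)).card) →
      (∀ j ∈ J, q ≤ (Q (k j)).card) →
      (∀ j ∈ J, (2 : ℝ) ^ (-((h - θ) * (Q (k j)).card)) ≤ w j) →
      (∀ y ∈ 𝒳.carrier, ∃ j ∈ J, ∀ p ∈ Q (k j), y p = x j p) →
      1 ≤ ∑ j ∈ J, w j := by
  classical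
  have hD1 : (0 : ℝ) < D := by exact_mod_cast hD0
  set θ' := θ / 2 with hθ'
  have hθ'0 : 0 < θ' := half_pos hθ
  -- The proportion of `Ω` that the disjoint tiles fill: half of `Ω` can serve as centres, and the
  -- Vitali selection costs a factor `D`.
  set p₀ : ℝ := 1 / (2 * D) with hp₀
  have hp₀0 : 0 < p₀ := by positivity
  -- The tiles save `θ' * p₀` per site, while the errors add up to `4 * η`.
  set η := θ' * p₀ / 5 with hη
  have hη0 : 0 < η := by positivity
  have hφ := 𝒳.isSubadd_logPatterns h𝒳
  obtain ⟨K, δ, hδ, hrel⟩ := hu.relative hφ hh hη0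
  obtain ⟨K', δ', hδ', hlow⟩ := hl η hη0
  -- On tiles of size at least `q`, half of the gain `θ` pays for the factor `2 ^ η - 1` attached to
  -- each tile below.
  obtain ⟨q, hq⟩ : ∃ q : ℝ, (2 : ℝ) ^ (-(θ' * q)) ≤ 2 ^ η - 1 := by
    have h1 : (1 : ℝ) < 2 ^ η := Real.one_lt_rpow (by norm_num) hη0
    refine ⟨-Real.logb 2 (2 ^ η - 1) / θ', le_of_eq ?_⟩
    rw [mul_div_cancel₀ _ hθ'0.ne', neg_neg]
    exact Real.rpow_logb (by norm_num) (by norm_num) (by linarith)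
  refine ⟨K, δ / 2, q, half_pos hδ, fun Q W hQ hne hW hD ι J k x w hout hqQ hw hcov => ?_⟩
  by_contra! hlt
  have hw0 : ∀ j ∈ J, 0 < w j := fun j hj => (Real.rpow_pos_of_pos two_pos _).trans_le (hw j hj)
  set Qm := Q (J.sup k) with hQm
  -- Invariance under `K` controls the remainder, under `K'` gives many patterns, and under the
  -- largest tile leaves room for centres.
  obtain ⟨Ω, hΩne, hΩ⟩ := hΓ (K ∪ (K' ∪ Qm)) (min (δ / 2) (min δ' (1 / 2))) (by positivity)
  have hΩpos : (0 : ℝ) < Ω.card := by exact_mod_cast hΩne.card_pos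
  have hΩK : ((innerBdry K Ω).card : ℝ) ≤ δ / 2 * Ω.card :=
    hΩ.mono Finset.subset_union_left (min_le_left _ _)
  have hΩK' : IsInvariant K' δ' Ω :=
    hΩ.mono (Finset.subset_union_left.trans Finset.subset_union_right)
      ((min_le_right _ _).trans (min_le_left _ _))
  have hΩQ : ((innerBdry Qm Ω).card : ℝ) ≤ 1 / 2 * Ω.card :=
    hΩ.mono (Finset.subset_union_right.trans Finset.subset_union_right)
      ((min_le_right _ _).trans (min_le_right _ _))
  set I := Ω \ innerBdry Qm Ω with hI
  have hIcard : 1 / 2 * (Ω.card : ℝ) ≤ I.card := by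
    rw [hI, Finset.cast_card_sdiff (innerBdry_subset Qm Ω)]; linarith
  -- the cylinder containing each translate, and the tiling it generates
  have hsel : ∀ y ∈ 𝒳.carrier, ∃ (j : Γ → ι) (C : Finset Γ), (∀ g, j g ∈ J) ∧
      (∀ g, ∀ p ∈ Q (k (j g)), y (p * g) = x (j g) p) ∧ C ⊆ I ∧
      (C : Set Γ).PairwiseDisjoint (fun c => translate (Q (k (j c))) c) ∧
      I.card ≤ D * ∑ c ∈ C, (Q (k (j c))).card := by
    intro y hy
    have h1 : ∀ g, ∃ j ∈ J, ∀ p ∈ Q (k j), y (p * g) = x j p :=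
      fun g => hcov _ (𝒳.shift_mem g y hy)
    choose j hjJ hj using h1
    obtain ⟨C, hC⟩ := exists_disjoint_translates hQ hne hW hD I (fun g => k (j g))
    exact ⟨j, C, hjJ, hj, hC⟩
  have : Nonempty ι := ⟨(hcov _ h𝒳.some_mem).choose⟩
  choose! j C hjJ hjx hCI hdisj hDI using hsel
  -- The encoding marks each site as a tile centre with its cylinder label, or as empty; `R` is the
  -- untiled remainder and `P` the tiled volume.
  let f : (Γ → A) → Ω → Option ι := fun y g => if g.1 ∈ C y then some (j y g) else none
  let R : (Ω → Option ι) → Finset Γ := fun b =>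
    Ω.filter fun p => ∀ (c : Ω) (i : ι), b c = some i → p ∉ translate (Q (k i)) c
  let P : (Ω → Option ι) → ℝ := fun b => ∑ c, (b c).elim 0 fun i => ((Q (k i)).card : ℝ)
  have hCΩ : ∀ y ∈ 𝒳.carrier, C y ⊆ Ω := fun y hy => (hCI y hy).trans Finset.sdiff_subset
  have hfsome : ∀ y c i, f y c = some i ↔ c.1 ∈ C y ∧ j y c = i := by
    intro y c i
    simp only [f]
    split_ifs with hc <;> simp [hc]
  have hRmem : ∀ y ∈ 𝒳.carrier, ∀ p, p ∈ R (f y) ↔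
      p ∈ Ω ∧ ∀ c ∈ C y, p ∉ translate (Q (k (j y c))) c := by
    intro y hy p
    simp only [R, Finset.mem_filter, hfsome]
    refine and_congr_right fun _ => ⟨fun H c hc => H ⟨c, hCΩ y hy hc⟩ _ ⟨hc, rfl⟩, ?_⟩
    rintro H c i ⟨hc, rfl⟩
    exact H c hc
  have hPf : ∀ y ∈ 𝒳.carrier, P (f y) = ∑ c ∈ C y, ((Q (k (j y c))).card : ℝ) := by
    intro y hy
    have h1 : ∀ c : Ω, (f y c).elim 0 (fun i => ((Q (k i)).card : ℝ)) =
        (fun g : Γ => if g ∈ C y then ((Q (k (j y g))).card : ℝ) else 0) c := by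
      intro c
      simp only [f]
      split_ifs <;> rfl
    simp only [P, h1]
    rw [Finset.sum_coe_sort Ω (fun g : Γ => if g ∈ C y then ((Q (k (j y g))).card : ℝ) else 0),
      ← Finset.sum_filter, Finset.filter_mem_eq_inter, Finset.inter_eq_right.2 (hCΩ y hy)]
  have htile : ∀ y ∈ 𝒳.carrier, ∀ c ∈ C y, translate (Q (k (j y c))) c ⊆ Ω := by
    intro y hy c hc p hp
    have hc' := hCI y hy hc
    simp only [hI, Finset.mem_sdiff, mem_innerBdry, not_and, not_exists, not_not] at hc'
    have := hc'.2 hc'.1 _ (hQ (Finset.le_sup (f := k) (hjJ y hy c)) (mem_translate.1 hp))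
    simpa using this
  have hRcard : ∀ y ∈ 𝒳.carrier, ((R (f y)).card : ℝ) = Ω.card - P (f y) := by
    intro y hy
    have e : R (f y) = Ω \ (C y).biUnion fun c => translate (Q (k (j y c))) c := by
      ext p
      rw [hRmem y hy]
      simp
    rw [e, Finset.cast_card_sdiff (Finset.biUnion_subset.2 (htile y hy)), hPf y hy,
      Finset.card_biUnion (hdisj y hy)]
    simp
  have hPle : ∀ y ∈ 𝒳.carrier, P (f y) ≤ Ω.card := by
    intro y hy
    have := hRcard y hy
    have : (0 : ℝ) ≤ (R (f y)).card := Nat.cast_nonneg _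
    linarith
  have hPge : ∀ y ∈ 𝒳.carrier, p₀ * Ω.card ≤ P (f y) := by
    intro y hy
    have h1 : (I.card : ℝ) ≤ D * P (f y) := by
      rw [hPf y hy]
      exact_mod_cast hDI y hy
    rw [hp₀, div_mul_eq_mul_div, div_le_iff₀ (by positivity)]
    linarith
  have hRφ : ∀ y ∈ 𝒳.carrier,
      𝒳.logPatterns (R (f y)) ≤ (h + 2 * η - θ' * p₀) * Ω.card - (h - θ') * P (f y) := by
    intro y hy
    have hb : ((innerBdry K (R (f y))).card : ℝ) ≤ δ * Ω.card := by
      have h1 : ((innerBdry K (R (f y))).card : ℝ) ≤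
          (innerBdry K Ω).card + ∑ c ∈ C y, ((outerBdry K (Q (k (j y c)))).card : ℝ) := by
        exact_mod_cast card_innerBdry_sdiff_le (K := K) (hRmem y hy)
      have h2 : ∑ c ∈ C y, ((outerBdry K (Q (k (j y c)))).card : ℝ) ≤ δ / 2 * P (f y) := by
        rw [hPf y hy, Finset.mul_sum]
        exact Finset.sum_le_sum fun c _ => hout _ (hjJ y hy c)
      have h3 : δ / 2 * P (f y) ≤ δ / 2 * Ω.card := by gcongr; exact hPle y hy
      linarith
    have h1 := hrel Ω _ hb
    rw [hRcard y hy] at h1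
    have h2 : θ' * (p₀ * Ω.card) ≤ θ' * P (f y) := by gcongr; exact hPge y hy
    have h3 : 0 ≤ η * P (f y) := mul_nonneg hη0.le (le_trans (by positivity) (hPge y hy))
    linarith
  -- weights of the encodings
  let v : Option ι → ℝ := fun o => o.elim 1 fun i => (2 ^ η - 1) * w i
  have hτ : (0 : ℝ) < 2 ^ η - 1 := by
    have := Real.one_lt_rpow (x := 2) (by norm_num) hη0
    linarith
  set B := Fintype.piFinset fun _ : Ω => J.insertNone with hB
  have hv0 : ∀ o ∈ J.insertNone, 0 ≤ v o := by
    intro o ho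
    cases o with
    | none => simp [v]
    | some i => exact mul_nonneg hτ.le (hw0 i (by simpa using ho)).le
  have hfB : ∀ y ∈ 𝒳.carrier, f y ∈ B := by
    intro y hy
    rw [hB, Fintype.mem_piFinset]
    intro c
    simp only [f]
    split_ifs
    · simpa using hjJ y hy c
    · simp
  have hprod : ∀ b ∈ B, (2 : ℝ) ^ (-((h - θ') * P b)) ≤ ∏ c, v (b c) := by
    intro b hb
    rw [hB, Fintype.mem_piFinset] at hb
    have e : (2 : ℝ) ^ (-((h - θ') * P b)) =
        ∏ c, (2 : ℝ) ^ (-((h - θ') * (b c).elim 0 fun i => ((Q (k i)).card : ℝ))) := by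
      rw [← Real.rpow_sum_of_pos two_pos, Finset.sum_neg_distrib, ← Finset.mul_sum]
    rw [e]
    refine Finset.prod_le_prod (fun c _ => by positivity) fun c _ => ?_
    have hbc := hb c
    cases hbc' : b c with
    | none => simp [v]
    | some i =>
      have hi : i ∈ J := by simpa [hbc'] using hbc
      simp only [v, Option.elim_some]
      have e2 : -((h - θ') * ((Q (k i)).card : ℝ)) =
          -(θ' * (Q (k i)).card) + -((h - θ) * (Q (k i)).card) := by rw [hθ']; ring
      rw [e2, Real.rpow_add two_pos]
      refine mul_le_mul (le_trans ?_ hq) (hw i hi) (by positivity) hτ.le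
      refine Real.rpow_le_rpow_of_exponent_le (by norm_num) (neg_le_neg ?_)
      gcongr
      exact hqQ i hi
  -- The sum over all encodings factors over the sites; since the total weight is below one, each
  -- factor is at most `1 + (2 ^ η - 1)`.
  have hsum : ∑ b ∈ B, ∏ c, v (b c) ≤ (2 : ℝ) ^ (η * Ω.card) := by
    rw [hB, ← Finset.prod_univ_sum (fun _ : Ω => J.insertNone) (fun _ => v)]
    rw [Finset.prod_const, Finset.card_univ, Fintype.card_coe, Real.rpow_mul (by norm_num),
      Real.rpow_natCast]
    refine pow_le_pow_left₀ (Finset.sum_nonneg hv0) ?_ _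
    rw [Finset.sum_insertNone]
    simp only [v, Option.elim_none, Option.elim_some]
    rw [← Finset.mul_sum]
    nlinarith
  -- Only realised encodings are known to have disjoint tiles and a controlled remainder.
  set V := B.filter fun b => ∃ y ∈ 𝒳.carrier, f y = b with hV
  have hcount := ncard_patterns_le_sum (𝒳 := 𝒳) Ω V f
    (fun y hy => Finset.mem_filter.2 ⟨hfB y hy, y, hy, rfl⟩) R (by
      intro y hy z hz hyz p hp hpR
      rw [hRmem y hy] at hpR
      push Not at hpR
      obtain ⟨c, hc, hpc⟩ := hpR hp
      have h1 := (hfsome y ⟨c, hCΩ y hy hc⟩ _).2 ⟨hc, rfl⟩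
      rw [hyz, hfsome] at h1
      have h2 := hjx y hy c _ (mem_translate.1 hpc)
      have h3 := hjx z hz c (p * c⁻¹) (by rw [h1.2]; exact mem_translate.1 hpc)
      rw [h1.2] at h3
      simpa using h2.trans h3.symm)
  have hfinal : (2 : ℝ) ^ ((h - η) * Ω.card) ≤ 2 ^ ((h + 3 * η - θ' * p₀) * Ω.card) := by
    calc (2 : ℝ) ^ ((h - η) * Ω.card) ≤ 2 ^ 𝒳.logPatterns Ω :=
          Real.rpow_le_rpow_of_exponent_le (by norm_num) (hlow Ω hΩK')
      _ = (𝒳.patterns Ω).ncard := 𝒳.two_rpow_logPatterns h𝒳 Ω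
      _ ≤ ∑ b ∈ V, ((𝒳.patterns (R b)).ncard : ℝ) := by exact_mod_cast hcount
      _ ≤ ∑ b ∈ V, (2 : ℝ) ^ ((h + 2 * η - θ' * p₀) * Ω.card) * ∏ c, v (b c) := by
        refine Finset.sum_le_sum fun b hb => ?_
        obtain ⟨hbB, y, hy, rfl⟩ := Finset.mem_filter.1 hb
        rw [← 𝒳.two_rpow_logPatterns h𝒳]
        refine (Real.rpow_le_rpow_of_exponent_le (by norm_num) (hRφ y hy)).trans ?_
        rw [sub_eq_add_neg, Real.rpow_add two_pos]
        gcongr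
        exact hprod _ hbB
      _ ≤ ∑ b ∈ B, (2 : ℝ) ^ ((h + 2 * η - θ' * p₀) * Ω.card) * ∏ c, v (b c) := by
        refine Finset.sum_le_sum_of_subset_of_nonneg (Finset.filter_subset _ _) fun b hb _ => ?_
        exact mul_nonneg (by positivity)
          (Finset.prod_nonneg fun c _ => hv0 _ (Fintype.mem_piFinset.1 hb c))
      _ ≤ (2 : ℝ) ^ ((h + 2 * η - θ' * p₀) * Ω.card) * 2 ^ (η * Ω.card) := by
        rw [← Finset.mul_sum]
        gcongr
      _ = _ := by
        rw [← Real.rpow_add two_pos]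
        congr 1
        ring
  rw [Real.rpow_le_rpow_left_iff (by norm_num)] at hfinal
  have h1 := le_of_mul_le_mul_right hfinal hΩpos
  have h2 : θ' * p₀ = 5 * η := by rw [hη]; ring
  linarith

end Tiling

/-! ### The lower bound for mean Hausdorff dimension. -/

section LowerBound

variable {G₁ G₂ A : Type*} [Group G₁] [Group G₂] {S₁ : SymmGenSet G₁} {S₂ : SymmGenSet G₂}
  [TopologicalSpace A] {𝒳 : Subshift (G₁ × G₂) A}

/-- Every set of small diameter lies in a cylinder whose size is controlled by the diameter, up to
an arbitrarily small error. -/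
theorem exists_cylinder (h𝒳 : 𝒳.carrier.Nonempty) {F : Finset G₁} {s : ℝ} (hs : 0 < s) {k₀ : ℕ}
    {ε : ℝ} (hε : ε ≤ (2⁻¹ : ℝ) ^ (k₀ + 1)) {E : Set 𝒳.carrier}
    (hE : diam (dynDist 𝒳.sigmaOne (𝒳.dist S₁ S₂) F) E < ENNReal.ofReal ε) {τ : ℝ≥0∞}
    (hτ : 0 < τ) :
    ∃ (k : ℕ) (x : G₁ × G₂ → A), k₀ ≤ k ∧
      (∀ y ∈ E, ∀ p ∈ window S₁ S₂ (k + 1) F, y.1 p = x p) ∧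
      ENNReal.ofReal ((2⁻¹ : ℝ) ^ (k + 1)) ^ s ≤
        diam (dynDist 𝒳.sigmaOne (𝒳.dist S₁ S₂) F) E ^ s + τ := by
  set r := diam (dynDist 𝒳.sigmaOne (𝒳.dist S₁ S₂) F) E with hr
  obtain ⟨x, hx⟩ : ∃ x : 𝒳.carrier, E.Nonempty → x ∈ E := by
    rcases E.eq_empty_or_nonempty with h | ⟨x, hx⟩
    · exact ⟨⟨_, h𝒳.some_mem⟩, fun h' => absurd h h'.ne_empty⟩
    · exact ⟨x, fun _ => hx⟩
  have hd : ∀ y ∈ E, (dynDist 𝒳.sigmaOne (𝒳.dist S₁ S₂) F y x : ℝ≥0∞) ≤ r :=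
    fun y hy => dist_le_diam hy (hx ⟨y, hy⟩)
  -- A set of diameter zero lies in cylinders over arbitrarily large windows, so a large `k` makes
  -- the cost smaller than `τ`.
  rcases eq_or_ne r 0 with h0 | h0
  · have ht : Tendsto (fun k : ℕ => ENNReal.ofReal ((2⁻¹ : ℝ) ^ (k + 1)) ^ s) atTop (𝓝 0) := by
      have h1 : Tendsto (fun k : ℕ => (2⁻¹ : ℝ) ^ (k + 1)) atTop (𝓝 0) :=
        (tendsto_pow_atTop_nhds_zero_of_lt_one (by norm_num) (by norm_num)).comp
          (tendsto_add_atTop_nat 1)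
      have h2 := ENNReal.tendsto_ofReal h1
      rw [ENNReal.ofReal_zero] at h2
      have h3 := (ENNReal.continuous_rpow_const (y := s)).tendsto 0
      rw [ENNReal.zero_rpow_of_pos hs] at h3
      exact h3.comp h2
    obtain ⟨k, hk, hk'⟩ := ((ht.eventually_lt_const hτ).and (eventually_ge_atTop k₀)).exists
    refine ⟨k, x.1, hk', fun y hy => ?_, hk.le.trans le_add_self⟩
    have := hd y hy
    rw [h0, nonpos_iff_eq_zero, ENNReal.coe_eq_zero] at this
    rw [← dynDist_le_iff, this]
    positivity
  · have hrtop : r ≠ ∞ := hE.ne_top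
    have hrpos : 0 < r.toReal := ENNReal.toReal_pos h0 hrtop
    have hrε : r.toReal < ε := by
      have hεpos : 0 < ε := by
        by_contra! hle
        rw [ENNReal.ofReal_of_nonpos hle] at hE
        exact not_lt_bot hE
      rw [← ENNReal.ofReal_toReal hrtop, ENNReal.ofReal_lt_ofReal_iff hεpos] at hE
      exact hE
    have hex : ∃ m : ℕ, (2⁻¹ : ℝ) ^ m ≤ r.toReal :=
      (exists_pow_lt_of_lt_one hrpos (by norm_num)).imp fun _ h => h.le
    obtain ⟨m, hm, hm'⟩ : ∃ m : ℕ, (2⁻¹ : ℝ) ^ m ≤ r.toReal ∧ ∀ j < m, r.toReal < (2⁻¹ : ℝ) ^ j :=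
      ⟨Nat.find hex, Nat.find_spec hex, fun j hj => not_le.1 (Nat.find_min hex hj)⟩
    -- The least `m` with `2⁻¹ ^ m ≤ r` is the window index: distances below `2⁻¹ ^ (m - 1)` are
    -- already at most `2⁻¹ ^ m`.
    have hkm : k₀ + 1 < m := by
      have := (hm.trans_lt hrε).trans_le hε
      rwa [pow_lt_pow_iff_right_of_lt_one₀ (by norm_num) (by norm_num)] at this
    obtain ⟨k, rfl⟩ : ∃ k, m = k + 1 := ⟨m - 1, by omega⟩
    refine ⟨k, x.1, by omega, fun y hy => ?_, le_trans ?_ le_self_add⟩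
    · rw [← dynDist_le_iff]
      refine dynDist_lt_pow ?_
      have h1 := ENNReal.toReal_mono hrtop (hd y hy)
      rw [ENNReal.coe_toReal] at h1
      rw [← NNReal.coe_lt_coe]
      push_cast
      exact h1.trans_lt (hm' k (Nat.lt_succ_self k))
    · refine ENNReal.rpow_le_rpow ?_ hs.le
      rw [← ENNReal.ofReal_toReal hrtop]
      exact ENNReal.ofReal_le_ofReal hm

variable [Finite A] [DiscreteTopology A]

/-- If cylinder covers have total weight at least one, then so do the Hausdorff sums. -/
theorem one_le_hausdorffSum (h𝒳 : 𝒳.carrier.Nonempty) {F : Finset G₁} {s : ℝ≥0} (hs : 0 < s)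
    {k₀ : ℕ} {ε : ℝ} (hε : ε ≤ (2⁻¹ : ℝ) ^ (k₀ + 1))
    (H : ∀ (J : Finset ℕ) (k : ℕ → ℕ) (x : ℕ → G₁ × G₂ → A), (∀ j, k₀ ≤ k j) →
      (∀ y ∈ 𝒳.carrier, ∃ j ∈ J, ∀ p ∈ window S₁ S₂ (k j + 1) F, y p = x j p) →
      1 ≤ ∑ j ∈ J, ((2⁻¹ : ℝ) ^ (k j + 1)) ^ (s : ℝ)) :
    1 ≤ hausdorffSum (dynDist 𝒳.sigmaOne (𝒳.dist S₁ S₂) F) s ε := by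
  unfold hausdorffSum
  refine le_iInf fun E => le_iInf fun hcov => le_iInf fun hE => ?_
  by_contra! hlt
  -- The enlargement errors together stay below the deficit from one; compactness then reduces the
  -- open cylinders to finitely many.
  obtain ⟨τ, hτ0, hτ⟩ := ENNReal.exists_pos_sum_of_countable (tsub_pos_of_lt hlt).ne' ℕ
  have hcyl := fun n => exists_cylinder h𝒳 (by exact_mod_cast hs : (0 : ℝ) < s) hε (hE n)
    (τ := τ n) (by exact_mod_cast hτ0 n)
  choose k x hk hx hkτ using hcyl
  have hcomp : IsCompact 𝒳.carrier := by
    have : CompactSpace (G₁ × G₂ → A) := inferInstance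
    exact 𝒳.isClosed.isCompact
  obtain ⟨J, hJ⟩ := hcomp.elim_finite_subcover
    (fun n => {y : G₁ × G₂ → A | ∀ p ∈ window S₁ S₂ (k n + 1) F, y p = x n p}) (fun n => by
      have e : {y : G₁ × G₂ → A | ∀ p ∈ window S₁ S₂ (k n + 1) F, y p = x n p} =
          ⋂ p ∈ window S₁ S₂ (k n + 1) F, (fun y : G₁ × G₂ → A => y p) ⁻¹' {x n p} := by
        ext; simp
      rw [e]
      exact isOpen_biInter_finset fun p _ =>
        (isOpen_discrete {x n p}).preimage (continuous_apply p)) (fun y hy => by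
      obtain ⟨n, hn⟩ := Set.mem_iUnion.1 (hcov.symm ▸ Set.mem_univ (⟨y, hy⟩ : 𝒳.carrier))
      exact Set.mem_iUnion.2 ⟨n, hx n _ hn⟩)
  have h1 := H J k x hk fun y hy => by
    obtain ⟨j, hj, h⟩ := Set.mem_iUnion₂.1 (hJ hy)
    exact ⟨j, hj, h⟩
  have h2 : (1 : ℝ≥0∞) ≤ ∑ j ∈ J, ENNReal.ofReal ((2⁻¹ : ℝ) ^ (k j + 1)) ^ (s : ℝ) := by
    have e : ∀ j, ENNReal.ofReal ((2⁻¹ : ℝ) ^ (k j + 1)) ^ (s : ℝ) =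
        ENNReal.ofReal (((2⁻¹ : ℝ) ^ (k j + 1)) ^ (s : ℝ)) :=
      fun j => ENNReal.ofReal_rpow_of_pos (by positivity)
    simp_rw [e]
    rw [← ENNReal.ofReal_sum_of_nonneg fun j _ => by positivity, ← ENNReal.ofReal_one]
    exact ENNReal.ofReal_le_ofReal h1
  have h3 : ∑ j ∈ J, ENNReal.ofReal ((2⁻¹ : ℝ) ^ (k j + 1)) ^ (s : ℝ) < 1 := by
    calc _ ≤ ∑' n, (diam (dynDist 𝒳.sigmaOne (𝒳.dist S₁ S₂) F) (E n) ^ (s : ℝ) + τ n) :=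
          (Finset.sum_le_sum fun j _ => hkτ j).trans (ENNReal.sum_le_tsum J)
      _ = ∑' n, diam (dynDist 𝒳.sigmaOne (𝒳.dist S₁ S₂) F) (E n) ^ (s : ℝ) + ∑' n, (τ n : ℝ≥0∞) :=
          ENNReal.tsum_add
      _ < ∑' n, diam (dynDist 𝒳.sigmaOne (𝒳.dist S₁ S₂) F) (E n) ^ (s : ℝ) +
            (1 - ∑' n, diam (dynDist 𝒳.sigmaOne (𝒳.dist S₁ S₂) F) (E n) ^ (s : ℝ)) :=
          ENNReal.add_lt_add_left hlt.ne_top hτ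
      _ = 1 := add_tsub_cancel_of_le hlt.le
  exact absurd (h2.trans_lt h3) (lt_irrefl _)

/-- The range of `ε` does not depend on `N`: the boxes `B_{k+N} × B_k` with `k ≥ k₀` are invariant
and doubling with the same constants for every `N`. The exponent fits because such a box has at
least `c (k + 1) |B_N|` elements. -/
theorem le_hausdorffDimAt (h𝒳 : 𝒳.carrier.Nonempty) {D₁ D₂ : ℕ}
    (hD₁ : ∀ n, (S₁.ball (2 * n)).card ≤ D₁ * (S₁.ball n).card)
    (hD₂ : ∀ n, (S₂.ball (2 * n)).card ≤ D₂ * (S₂.ball n).card)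
    {h : ℝ} (hu : IsUpperRate 𝒳.logPatterns h) (hl : IsLowerRate 𝒳.logPatterns h)
    (hΓ : ∀ (K : Finset (G₁ × G₂)) (δ : ℝ), 0 < δ →
      ∃ T : Finset (G₁ × G₂), T.Nonempty ∧ IsInvariant K δ T)
    {h' c : ℝ} (hh' : 0 < h') (hh : h' < h) (hc : 0 < c)
    (hball : ∀ᶠ k : ℕ in atTop, c * (k + 1) ≤ (S₂.ball k).card) :
    ∀ᶠ ε : ℝ in 𝓝[>] 0, ∀ N : ℕ, ENNReal.ofReal (c * h' * (S₁.ball N).card) ≤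
      hausdorffDimAt (dynDist 𝒳.sigmaOne (𝒳.dist S₁ S₂) (S₁.ball N)) ε := by
  classical
  have hD₁0 : 1 ≤ D₁ := by
    have h1 := (S₁.card_ball_pos (2 * 0)).trans_le (hD₁ 0)
    exact Nat.pos_of_mul_pos_right h1
  have hD₂0 : 1 ≤ D₂ := by
    have h1 := (S₂.card_ball_pos (2 * 0)).trans_le (hD₂ 0)
    exact Nat.pos_of_mul_pos_right h1
  obtain ⟨K, δ, q, hδ, key⟩ := one_le_sum_of_cylinder_cover h𝒳 (hh'.trans hh).le hu hl hΓ
    (sub_pos.2 hh) (Nat.mul_pos hD₁0 hD₂0)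
  obtain ⟨K₁, K₂, hK⟩ := exists_subset_product (K.map (Equiv.inv (G₁ × G₂)).toEmbedding)
  -- Each factor contributes `ζ` to the inner boundary, and passing to the outer boundary costs a
  -- factor `|K|`.
  set ζ := δ / (2 * (K.card + 1)) with hζ
  have hζ0 : 0 < ζ := by positivity
  have e1 := (S₁.isFolnerSeq_ball hD₁).eventually_isInvariant K₁ hζ0
  have e2 := (S₂.isFolnerSeq_ball hD₂).eventually_isInvariant K₂ hζ0
  have e3 : ∀ᶠ k : ℕ in atTop, q ≤ c * (k + 1) := by
    have : Tendsto (fun k : ℕ => c * ((k : ℝ) + 1)) atTop atTop :=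
      (tendsto_atTop_add_const_right _ _ tendsto_natCast_atTop_atTop).const_mul_atTop hc
    exact this.eventually_ge_atTop q
  obtain ⟨k₀, hk₀⟩ := eventually_atTop.1 (e1.and (e2.and (e3.and hball)))
  filter_upwards [Ioc_mem_nhdsGT (show (0 : ℝ) < 2⁻¹ ^ (k₀ + 1) by positivity)] with ε hε N
  have hN : (0 : ℝ) < (S₁.ball N).card := by exact_mod_cast S₁.card_ball_pos N
  have hs : 0 < c * h' * (S₁.ball N).card := by positivity
  refine le_iSup₂_of_le (c * h' * (S₁.ball N).card).toNNReal ?_ le_rfl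
  refine one_le_hausdorffSum h𝒳 (Real.toNNReal_pos.2 hs) hε.2 fun J k x hk hcov => ?_
  rw [Real.coe_toNNReal _ hs.le]
  simp only [window_ball] at hcov
  have hlarge : ∀ j, c * (k j + 1) * (S₁.ball N).card ≤
      ((S₁.ball (k j + N) ×ˢ S₂.ball (k j)).card : ℝ) := by
    intro j
    rw [Finset.card_product, mul_comm]
    push_cast
    have h1 := (hk₀ (k j) (hk j)).2.2.2
    have h2 : ((S₁.ball N).card : ℝ) ≤ (S₁.ball (k j + N)).card := by
      exact_mod_cast Finset.card_le_card (S₁.ball_mono (by omega))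
    gcongr
  refine key (fun k => S₁.ball (k + N) ×ˢ S₂.ball k)
    (fun k => S₁.ball (2 * (k + N)) ×ˢ S₂.ball (2 * k))
    (fun k k' hkk => Finset.product_subset_product (S₁.ball_mono (by omega)) (S₂.ball_mono hkk))
    (fun k => (S₁.ball_nonempty _).product (S₂.ball_nonempty _))
    (fun k a ha b hb => ?_) (fun k => ?_) J k x _ (fun j _ => ?_) (fun j _ => ?_) (fun j _ => ?_)
    hcov
  · rw [Finset.mem_product] at ha hb ⊢
    have i1 : a.1⁻¹ ∈ S₁.ball (k + N) := by
      rw [SymmGenSet.mem_ball, SymmGenSet.wordLength_inv]; exact S₁.mem_ball.1 ha.1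
    have i2 : a.2⁻¹ ∈ S₂.ball k := by
      rw [SymmGenSet.mem_ball, SymmGenSet.wordLength_inv]; exact S₂.mem_ball.1 ha.2
    rw [two_mul, two_mul]
    exact ⟨S₁.mul_mem_ball i1 hb.1, S₂.mul_mem_ball i2 hb.2⟩
  · rw [Finset.card_product, Finset.card_product]
    calc _ ≤ D₁ * (S₁.ball (k + N)).card * (D₂ * (S₂.ball k).card) :=
          Nat.mul_le_mul (hD₁ _) (hD₂ _)
      _ = _ := by ring
  · have h1 : IsInvariant (K.map (Equiv.inv (G₁ × G₂)).toEmbedding) (ζ + ζ)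
        (S₁.ball (k j + N) ×ˢ S₂.ball (k j)) :=
      IsInvariant.prod hK (hk₀ (k j + N) ((hk j).trans (Nat.le_add_right _ _))).1
        (hk₀ (k j) (hk j)).2.1
    have h2 : ((outerBdry K (S₁.ball (k j + N) ×ˢ S₂.ball (k j))).card : ℝ) ≤ K.card *
        (innerBdry (K.map (Equiv.inv (G₁ × G₂)).toEmbedding)
          (S₁.ball (k j + N) ×ˢ S₂.ball (k j))).card := by
      exact_mod_cast card_outerBdry_le _ _
    refine h2.trans ((mul_le_mul (by linarith : (K.card : ℝ) ≤ K.card + 1) h1 (by positivity)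
      (by positivity)).trans (le_of_eq ?_))
    rw [hζ]
    field_simp
    ring
  · have h1 : (1 : ℝ) ≤ (S₁.ball N).card := by exact_mod_cast S₁.card_ball_pos N
    have h2 := (hk₀ (k j) (hk j)).2.2.1
    refine le_trans ?_ (hlarge j)
    have : 0 ≤ c * ((k j : ℝ) + 1) := by positivity
    nlinarith
  · rw [← Real.rpow_natCast, ← Real.rpow_mul (by norm_num), Real.inv_rpow (by norm_num),
      ← Real.rpow_neg (by norm_num)]
    refine Real.rpow_le_rpow_of_exponent_le (by norm_num) (neg_le_neg ?_)
    have e : h - (h - h') = h' := by ring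
    rw [e]
    push_cast
    calc ((k j : ℝ) + 1) * (c * h' * (S₁.ball N).card) =
          h' * (c * (k j + 1) * (S₁.ball N).card) := by ring
      _ ≤ _ := by gcongr; exact hlarge j

theorem le_lowerMeanHausdorffDim (h𝒳 : 𝒳.carrier.Nonempty) {D₁ D₂ : ℕ}
    (hD₁ : ∀ n, (S₁.ball (2 * n)).card ≤ D₁ * (S₁.ball n).card)
    (hD₂ : ∀ n, (S₂.ball (2 * n)).card ≤ D₂ * (S₂.ball n).card)
    {h : ℝ} (hu : IsUpperRate 𝒳.logPatterns h) (hl : IsLowerRate 𝒳.logPatterns h)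
    (hΓ : ∀ (K : Finset (G₁ × G₂)) (δ : ℝ), 0 < δ →
      ∃ T : Finset (G₁ × G₂), T.Nonempty ∧ IsInvariant K δ T) :
    lowerLinearRate S₂ * ENNReal.ofReal h ≤
      lowerMeanHausdorffDim 𝒳.sigmaOne (𝒳.dist S₁ S₂) S₁.ball := by
  -- Strict slack below both factors: `b` leaves an entropy gap, and the gap between `a` and `c₀`
  -- absorbs the shift from `k` to `k + 1`.
  refine ENNReal.mul_le_of_forall_lt fun a ha b hb => ?_
  obtain ⟨c₀, hac₀, hc₀⟩ := ENNReal.lt_iff_exists_nnreal_btwn.1 ha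
  have hatop : a ≠ ∞ := hac₀.ne_top
  have hbtop : b ≠ ∞ := hb.ne_top
  rcases eq_or_ne a 0 with rfl | ha0
  · simp
  rcases eq_or_ne b 0 with rfl | hb0
  · simp
  have hap : 0 < a.toReal := ENNReal.toReal_pos ha0 hatop
  have hbp : 0 < b.toReal := ENNReal.toReal_pos hb0 hbtop
  have hbh : b.toReal < h := ENNReal.lt_ofReal_iff_toReal_lt hbtop |>.1 hb
  have hac : a.toReal < c₀ := by
    rw [← ENNReal.coe_toReal]
    exact ENNReal.toReal_strict_mono ENNReal.coe_ne_top hac₀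
  have hball : ∀ᶠ k : ℕ in atTop, a.toReal * (k + 1) ≤ (S₂.ball k).card := by
    have h2 : Tendsto (fun k : ℕ => ((c₀ : ℝ) - a.toReal) * (k : ℝ)) atTop atTop :=
      tendsto_natCast_atTop_atTop.const_mul_atTop (sub_pos.2 hac)
    filter_upwards [eventually_lt_of_lt_liminf hc₀, h2.eventually_ge_atTop a.toReal,
      eventually_ge_atTop 1] with k hk hk2 hk1
    have hk0 : (0 : ℝ) < k := by exact_mod_cast hk1
    rw [← ENNReal.ofReal_natCast (S₂.ball k).card, ofReal_div_card hk1,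
      ENNReal.lt_ofReal_iff_toReal_lt ENNReal.coe_ne_top, ENNReal.coe_toReal,
      lt_div_iff₀ hk0] at hk
    linarith
  refine ge_of_tendsto (tendsto_lowerHausdorffRate _ _ _) ?_
  filter_upwards [le_hausdorffDimAt h𝒳 hD₁ hD₂ hu hl hΓ hbp hbh hap hball] with ε hε
  refine le_liminf_of_le (h := Eventually.of_forall fun N => ?_)
  have hN := S₁.card_ball_pos N
  calc a * b = ENNReal.ofReal (a.toReal * b.toReal) := by
        rw [ENNReal.ofReal_mul hap.le, ENNReal.ofReal_toReal hatop, ENNReal.ofReal_toReal hbtop]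
    _ = ENNReal.ofReal (a.toReal * b.toReal * (S₁.ball N).card) / ((S₁.ball N).card : ℝ≥0∞) := by
        rw [ofReal_div_card hN, mul_div_cancel_right₀]
        exact_mod_cast hN.ne'
    _ ≤ _ := ENNReal.div_le_div_right (hε N) _

end LowerBound

/-! ### Comparison of mean Hausdorff and metric mean dimension. -/

/-- An optimal `ε'`-cover by `N` sets has `s`-sum at most `N * ε' ^ s`, which is below one as soon
as `s` exceeds the ratio of logarithms. -/
theorem hausdorffDimAt_le {X : Type*} [TopologicalSpace X] {d : X → X → ℝ≥0} {ε ε' : ℝ}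
    (h0 : 0 < ε') (h1 : ε' < 1) (hle : ε' ≤ ε) (hN : 0 < openCoveringNumber d ε') :
    hausdorffDimAt d ε ≤ log2 (openCoveringNumber d ε') / ENNReal.ofReal |Real.logb 2 ε'| := by
  have hmem := Nat.sInf_mem (Nat.nonempty_of_pos_sInf hN)
  rw [← openCoveringNumber] at hmem
  obtain ⟨N, hNdef⟩ : ∃ N, openCoveringNumber d ε' = N := ⟨_, rfl⟩
  rw [hNdef] at hmem hN ⊢
  obtain ⟨U, -, hU, hcov⟩ := hmem
  have hlog : Real.logb 2 ε' < 0 := Real.logb_neg (by norm_num) h0 h1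
  refine iSup₂_le fun s hs => ?_
  by_contra! hlt
  have hs0 : 0 < s := by
    rw [pos_iff_ne_zero]
    rintro rfl
    simp at hlt
  have hs0' : (0 : ℝ) < s := hs0
  have hreal : Real.logb 2 N < s * |Real.logb 2 ε'| := by
    have hL : 0 < |Real.logb 2 ε'| := abs_pos.2 hlog.ne
    rw [ENNReal.div_lt_iff (Or.inl (by simpa using hlog.ne)) (Or.inl ENNReal.ofReal_ne_top), log2,
      ← ENNReal.ofReal_coe_nnreal, ← ENNReal.ofReal_mul hs0'.le,
      ENNReal.ofReal_lt_ofReal_iff (by positivity)] at hlt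
    exact hlt
  have hNpos : (0 : ℝ) < N := by exact_mod_cast hN
  have hsmall : (N : ℝ) * ε' ^ (s : ℝ) < 1 := by
    rw [abs_of_neg hlog] at hreal
    have h2 : Real.logb 2 ((N : ℝ) * ε' ^ (s : ℝ)) < 0 := by
      rw [Real.logb_mul hNpos.ne' (by positivity), Real.logb_rpow_eq_mul_logb_of_pos h0]
      linarith
    by_contra! hge
    exact absurd h2 (not_lt.2 (Real.logb_nonneg (by norm_num) hge))
  -- Padding with empty sets is free because `s > 0`.
  let E : ℕ → Set X := fun n => if h : n < N then U ⟨n, h⟩ else ∅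
  have hdE : ∀ n, diam d (E n) < ENNReal.ofReal ε' := by
    intro n
    by_cases h : n < N
    · simp only [E]
      rw [dif_pos h]
      exact hU ⟨n, h⟩
    · simp only [E, h, dif_neg, not_false_eq_true]
      simpa [diam] using h0
  have hEcov : ⋃ n, E n = univ := by
    refine Set.eq_univ_of_forall fun x => ?_
    obtain ⟨i, hi⟩ := Set.mem_iUnion.1 (hcov.symm ▸ Set.mem_univ x)
    exact Set.mem_iUnion.2 ⟨i, by simp only [E]; rw [dif_pos i.2]; exact hi⟩
  have hH : hausdorffSum d s ε ≤ ∑' n, diam d (E n) ^ (s : ℝ) :=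
    iInf_le_of_le E (iInf_le_of_le hEcov (iInf_le_of_le
      (fun n => (hdE n).trans_le (ENNReal.ofReal_le_ofReal hle)) le_rfl))
  have hsum : ∑' n, diam d (E n) ^ (s : ℝ) ≤ N * ENNReal.ofReal ε' ^ (s : ℝ) := by
    rw [tsum_eq_sum (s := Finset.range N) fun n hn => by
      have h : ¬ n < N := by simpa using hn
      simp only [E, h, dif_neg, not_false_eq_true]
      simpa [diam] using hs0]
    refine (Finset.sum_le_card_nsmul _ _ _ fun n _ =>
      ENNReal.rpow_le_rpow (hdE n).le hs0'.le).trans ?_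
    simp
  have hlt1 : (N : ℝ≥0∞) * ENNReal.ofReal ε' ^ (s : ℝ) < 1 := by
    rw [ENNReal.ofReal_rpow_of_pos h0, ← ENNReal.ofReal_natCast, ← ENNReal.ofReal_mul hNpos.le,
      ENNReal.ofReal_lt_one]
    exact hsmall
  exact absurd ((hs.trans hH).trans hsum) (not_le.2 hlt1)

/-- The upper mean Hausdorff dimension is at most the lower metric mean dimension. -/
theorem upperMeanHausdorffDim_le_lowerMetricMeanDim {X Γ : Type*} [TopologicalSpace X]
    (T : Γ → X → X) (d : X → X → ℝ≥0) (F F' : ℕ → Finset Γ)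
    (hpos : ∀ ε : ℝ, 0 < ε → ∀ n, 0 < openCoveringNumber (dynDist T d (F n)) ε)
    (hlim : ∀ ε : ℝ, 0 < ε → Tendsto (coverRate T d F ε) atTop (𝓝 (coverEntropy T d F' ε))) :
    upperMeanHausdorffDim T d F ≤ lowerMetricMeanDim T d F' := by
  refine le_of_tendsto (tendsto_upperHausdorffRate T d F) ?_
  filter_upwards [self_mem_nhdsWithin] with ε hε
  refine le_liminf_of_le (h := ?_)
  -- The Hausdorff scale `ε` stays fixed while the covering scale `ε'` tends to zero.
  filter_upwards [Ioo_mem_nhdsGT (lt_min (Set.mem_Ioi.1 hε) one_pos)] with ε' hε'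
  have h1 : ε' < 1 := hε'.2.trans_le (min_le_right _ _)
  have hlog : Real.logb 2 ε' < 0 := Real.logb_neg (by norm_num) hε'.1 h1
  have ht := ENNReal.Tendsto.div_const (hlim ε' hε'.1)
    (b := ENNReal.ofReal |Real.logb 2 ε'|) (Or.inr (by simpa using hlog.ne))
  rw [← ht.limsup_eq]
  refine limsup_le_limsup (Eventually.of_forall fun n => ?_)
  have h2 := hausdorffDimAt_le hε'.1 h1 (hε'.2.le.trans (min_le_left _ _)) (hpos ε' hε'.1 n)
  calc _ ≤ log2 (openCoveringNumber (dynDist T d (F n)) ε') / ENNReal.ofReal |Real.logb 2 ε'| /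
        ((F n).card : ℝ≥0∞) := ENNReal.div_le_div_right h2 _
    _ = _ := by
      simp only [coverRate, div_eq_mul_inv]
      rw [mul_right_comm]

end SubshiftMeanDim

/-! ### Assembly of the bounds. -/

theorem theorem1 {G₁ G₂ A : Type*} [Group G₁] [Group G₂]
    [Finite A] [TopologicalSpace A] [DiscreteTopology A]
    (d₁ : ℝ) (hG₁ : HasPolynomialGrowth G₁ d₁) (hG₂ : HasPolynomialGrowth G₂ 1)
    (S₁ : SymmGenSet G₁) (S₂ : SymmGenSet G₂)
    (𝒳 : Subshift (G₁ × G₂) A) (h𝒳 : 𝒳.carrier.Nonempty)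
    (F : ℕ → Finset G₁) (hF : IsFolnerSeq F)
    (E : ℕ → Finset (G₁ × G₂)) (hE : IsFolnerSeq E) :
    -- the limits defining `S(𝒳, G₁, d, ε)` and `h_top(𝒳, G)` exist, the balls are a Følner sequence
    (∀ ε : ℝ, 0 < ε → Tendsto (coverRate 𝒳.sigmaOne (𝒳.dist S₁ S₂) F ε) atTop
      (𝓝 (coverEntropy 𝒳.sigmaOne (𝒳.dist S₁ S₂) F ε))) ∧
    Tendsto (𝒳.patternRate E) atTop (𝓝 (𝒳.topEntropy E)) ∧
    IsFolnerSeq S₁.ball ∧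
    -- (1)
    upperMetricMeanDim 𝒳.sigmaOne (𝒳.dist S₁ S₂) F ≤ upperLinearRate S₂ * 𝒳.topEntropy E ∧
    -- (2)
    lowerLinearRate S₂ * 𝒳.topEntropy E ≤
      lowerMeanHausdorffDim 𝒳.sigmaOne (𝒳.dist S₁ S₂) S₁.ball ∧
    -- the case `c₁ = c₂ = c`
    (∀ c : ℝ≥0∞, upperLinearRate S₂ = c → lowerLinearRate S₂ = c →
      upperMeanHausdorffDim 𝒳.sigmaOne (𝒳.dist S₁ S₂) S₁.ball = c * 𝒳.topEntropy E ∧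
      lowerMeanHausdorffDim 𝒳.sigmaOne (𝒳.dist S₁ S₂) S₁.ball = c * 𝒳.topEntropy E ∧
      upperMetricMeanDim 𝒳.sigmaOne (𝒳.dist S₁ S₂) F = c * 𝒳.topEntropy E ∧
      lowerMetricMeanDim 𝒳.sigmaOne (𝒳.dist S₁ S₂) F = c * 𝒳.topEntropy E) := by

  have hφ := 𝒳.isSubadd_logPatterns h𝒳
  have hΓ : ∀ (K : Finset (G₁ × G₂)) (δ : ℝ), 0 < δ →
      ∃ T : Finset (G₁ × G₂), T.Nonempty ∧ IsInvariant K δ T := fun K δ hδ =>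
    (hE.eventually_isInvariant K hδ).exists.imp' E fun n hn => ⟨hE.1 n, hn⟩
  have hΓ₁ : ∀ (K : Finset G₁) (δ : ℝ), 0 < δ →
      ∃ T : Finset G₁, T.Nonempty ∧ IsInvariant K δ T := fun K δ hδ =>
    (hF.eventually_isInvariant K hδ).exists.imp' F fun n hn => ⟨hF.1 n, hn⟩
  obtain ⟨h, -, hu, hl⟩ := hφ.exists_rate hΓ
  choose s _ hsu hsl using fun k => (isSubadd_window (S₁ := S₁) (S₂ := S₂) hφ k).exists_rate hΓ₁
  obtain ⟨D₁, -, hD₁⟩ := hG₁.doubling S₁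
  obtain ⟨D₂, -, hD₂⟩ := hG₂.doubling S₂
  have hB₁ := S₁.isFolnerSeq_ball hD₁
  have hB₂ := S₂.isFolnerSeq_ball hD₂
  have hE' := 𝒳.tendsto_patternRate hu hl hE
  have htop : 𝒳.topEntropy E = ENNReal.ofReal h := hE'.limsup_eq
  have hrate : ∀ F' : ℕ → Finset G₁, IsFolnerSeq F' → ∀ k (ε : ℝ), (2⁻¹ : ℝ) ^ k < ε →
      (∀ j < k, ε ≤ (2⁻¹ : ℝ) ^ j) → Tendsto (coverRate 𝒳.sigmaOne (𝒳.dist S₁ S₂) F' ε) atTop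
        (𝓝 (ENNReal.ofReal (s k))) :=
    fun F' hF' k ε hk hk' => tendsto_coverRate hk hk' (hsu k) (hsl k) hF'
  have hent : ∀ k (ε : ℝ), (2⁻¹ : ℝ) ^ k < ε → (∀ j < k, ε ≤ (2⁻¹ : ℝ) ^ j) →
      coverEntropy 𝒳.sigmaOne (𝒳.dist S₁ S₂) F ε = ENNReal.ofReal (s k) :=
    fun k ε hk hk' => (hrate F hF k ε hk hk').limsup_eq
  -- The limit is the same along every Følner sequence, so covering numbers along balls can be
  -- compared with the entropy defined by `F`.
  have hlim : ∀ F' : ℕ → Finset G₁, IsFolnerSeq F' → ∀ ε : ℝ, 0 < ε →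
      Tendsto (coverRate 𝒳.sigmaOne (𝒳.dist S₁ S₂) F' ε) atTop
        (𝓝 (coverEntropy 𝒳.sigmaOne (𝒳.dist S₁ S₂) F ε)) := by
    intro F' hF' ε hε
    obtain ⟨k, hk, hk'⟩ := exists_scale hε
    rw [hent k ε hk hk']
    exact hrate F' hF' k ε hk hk'
  have hupper : upperMetricMeanDim 𝒳.sigmaOne (𝒳.dist S₁ S₂) F ≤
      upperLinearRate S₂ * 𝒳.topEntropy E := by
    rw [htop]
    exact upperMetricMeanDim_le (upperLinearRate_ne_top hG₂ S₂) hent fun η hη =>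
      window_rate_le hφ hu hF hB₂ (fun k => (hsu k).tendsto (hsl k) hF) hη
  have hlower : lowerLinearRate S₂ * 𝒳.topEntropy E ≤
      lowerMeanHausdorffDim 𝒳.sigmaOne (𝒳.dist S₁ S₂) S₁.ball := by
    rw [htop]
    exact le_lowerMeanHausdorffDim h𝒳 hD₁ hD₂ hu hl hΓ
  refine ⟨hlim F hF, htop ▸ hE', hB₁, hupper, hlower, fun c hc₁ hc₂ => ?_⟩
  rw [hc₁] at hupper
  rw [hc₂] at hlower
  have i1 : lowerMeanHausdorffDim 𝒳.sigmaOne (𝒳.dist S₁ S₂) S₁.ball ≤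
      upperMeanHausdorffDim 𝒳.sigmaOne (𝒳.dist S₁ S₂) S₁.ball :=
    limsup_le_limsup (Eventually.of_forall fun ε => liminf_le_limsup)
  have i2 : upperMeanHausdorffDim 𝒳.sigmaOne (𝒳.dist S₁ S₂) S₁.ball ≤
      lowerMetricMeanDim 𝒳.sigmaOne (𝒳.dist S₁ S₂) F :=
    upperMeanHausdorffDim_le_lowerMetricMeanDim _ _ _ _ (fun ε hε n => by
      obtain ⟨k, hk, hk'⟩ := exists_scale hε
      rw [openCoveringNumber_eq hk hk']
      exact 𝒳.ncard_patterns_pos h𝒳 _) (hlim _ hB₁)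
  have i3 : lowerMetricMeanDim 𝒳.sigmaOne (𝒳.dist S₁ S₂) F ≤
      upperMetricMeanDim 𝒳.sigmaOne (𝒳.dist S₁ S₂) F := liminf_le_limsup
  exact ⟨le_antisymm (i2.trans (i3.trans hupper)) (hlower.trans i1),
    le_antisymm (i1.trans (i2.trans (i3.trans hupper))) hlower,
    le_antisymm hupper (hlower.trans (i1.trans (i2.trans i3))),
    le_antisymm (i3.trans hupper) (hlower.trans (i1.trans i2))⟩
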